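/- **Setting.** Let $\mathcal A$ be a finite set, let $T$ be the left shift on $\mathcal A^{\mathbb N}$, $\mathbb N=\{1,2,\dots\}$, and write $x_m^n=x_mx_{m+1}\cdots x_n$. Let $\mathbb P,\mathbb Q$ be shift-invariant probability measures on $\mathcal A^{\mathbb N}$ (with the product $\sigma$-algebra). For a word $a\in\mathcal A^n$ write $\mathbb P[a]=\mathbb P\{x:x_1^n=a\}$, and put $\operatorname{supp}\mathbb P_n=\{a\in\mathcal A^n:\mathbb P[a]>0\}$ and $\operatorname{supp}\mathbb P=\{x:\mathbb P[x_1^n]>0\text{ for all }n\}$; similarly for $\mathbb Q$. **Estimator.** For $x,y\in\mathcal A^{\mathbb N}$ let $$W_\ell(y,x)=\inf\{r\in\mathbb N: x_r^{r+\ell-1}=y_1^\ell\}\quad(\inf\emptyset=\infty),$$ $$\Lambda_N(y,x)=\max\bigl\{1,\ \sup\{\ell\in\mathbb N: W_\ell(y,x)\le N-\ell+1\}\bigr\}.$$ Set $L_0=0$ and, as long as $L_i<N$, $L_{i+1}=\min\{N,\ L_i+\Lambda_N(T^{L_i}y,x)+1\}$. The modified Ziv–Merhav parsing of $y_1^N$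 with respect to $x_1^N$ has the words $y_{L_i+1}^{L_{i+1}}$; let $c_N(y|x)$ be their number, i.e. the first $i$ with $L_i=N$. The modified Ziv–Merhav estimator is $$Q_N(y,x)=\frac{c_N(y|x)\ln N}{N-c_N(y|x)},$$ with $Q_N(y,x)=\infty$ if $c_N(y|x)=N$. **Conditions.** - UD for a measure $\mathbb P$: there are sequences $(k_n)_{n\ge1}\subset[0,\infty)$ and $(\tau_n)_{n\ge1}\subset\mathbb N\cup\{0\}$, both $o(n)$, such that $\mathbb P[a\xi b]\le e^{k_n}\mathbb P[a]\mathbb P[b]$ for all $n,m\in\mathbb N$, $a\in\operatorname{supp}\mathbb P_n$, $\xi\in\operatorname{supp}\mathbb P_{\tau_n}$, $b\in\operatorname{supp}\mathbb P_m$. - SLD for $\mathbb P$: there are $(k_n)$, $(\tau_n)$ as above such that for all $n,m\in\mathbb N$, $a\in\operatorname{supp}\mathbb P_n$, $b\in\operatorname{supp}\mathbb P_m$ there are $0\le\ell\le\tau_n$ and $\xi\in\operatorname{supp}\mathbb P_\ell$ with $\mathbb P[a\xi b]\ge e^{-k_n}\mathbb P[a]\mathbb P[b]$. - SE for $\mathbb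 P$: there are $\beta\ge1$ and $\gamma_-<0$ with $\mathbb P[a]\ge e^{\gamma_-n^\beta}$ for all $n\in\mathbb N$ and $a\in\operatorname{supp}\mathbb P_n$. - The cross-entropic pressure is the function $\overline q:\mathbb R\to[-\infty,\infty]$, $$\overline q(\alpha)=\limsup_{n\to\infty}\frac1n\ln\sum_{a\in\operatorname{supp}\mathbb P_n}\mathbb P[a]^{-\alpha}\,\mathbb Q[a].$$ - ND for the pair $(\mathbb P,\mathbb Q)$: $\overline q(-1)<0$. **Theorem.** Suppose that $\mathbb P$ satisfies SLD, UD and SE, that $\mathbb Q$ satisfies UD, that ND holds, and that $\operatorname{supp}\mathbb Q\subseteq\operatorname{supp}\mathbb P$. Then the one-sided derivatives $D_-\overline q(0)=\lim_{\alpha\uparrow0}\frac{\overline q(\alpha)-\overline q(0)}{\alpha}$ and $D_+\overline q(0)=\lim_{\alpha\downarrow0}\frac{\overline q(\alpha)-\overline q(0)}{\alpha}$ exist in $[-\infty,\infty]$, the real numbers in $[D_-\overline q(0),D_+\overline q(0)]$ are exactly those in the subdifferential $\{s\in\mathbb R:\overline q(\alpha)\ge\overline q(0)+s\alpha\text{ for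 all }\alpha\in\mathbb R\}$ of $\overline q$ at $0$, and for $(\mathbb P\otimes\mathbb Q)$-almost every $(x,y)$, $$D_-\overline q(0)\ \le\ \liminf_{N\to\infty}Q_N(y,x)\ \le\ \limsup_{N\to\infty}Q_N(y,x)\ \le\ D_+\overline q(0).$$ -/

import Mathlib

open Filter Topology MeasureTheory Asymptotics

namespace ZivMerhav

/-! Sequences `x = x₁x₂x₃…` with values in `A` are functions `x : ℕ → A`, with `x_k` written
as `x (k - 1)`. Words of length `n` are functions `Fin n → A`, and concatenation of words
is `Fin.append`. -/

variable {A : Type*}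

/-- The left shift `T`. -/
def shift (x : ℕ → A) : ℕ → A := fun k => x (k + 1)

/-- The prefix `x₁ⁿ`. -/
def firstWord (x : ℕ → A) (n : ℕ) : Fin n → A := fun i => x i

/-- The basic cylinder `[a] = {x : x₁ⁿ = a}`. -/
def wordCylinder {n : ℕ} (a : Fin n → A) : Set (ℕ → A) := {x | firstWord x n = a}

/-! ### The modified Ziv–Merhav estimator -/

/-- The waiting time `W_ℓ(y, x) = inf {r ≥ 1 : x_r^{r+ℓ-1} = y_1^ℓ}`, with value `∞` if there is
no such `r`. -/
noncomputable def waitingTime (l : ℕ) (y x : ℕ → A) : ℕ∞ :=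
  ⨅ (r : ℕ) (_ : 1 ≤ r ∧ ∀ i < l, x (r - 1 + i) = y i), (r : ℕ∞)

/-- The match length `Λ_N(y, x) = max {1, sup {ℓ ≥ 1 : W_ℓ(y, x) ≤ N - ℓ + 1}}`. The set is bounded
by `N` because `W_ℓ ≥ 1`; the supremum of the empty set is `0` here. -/
noncomputable def matchLength (N : ℕ) (y x : ℕ → A) : ℕ :=
  max 1 (sSup {l : ℕ | 1 ≤ l ∧ waitingTime l y x + l ≤ N + 1})

/-- `parseEnd N y x i` is the total length `L_i` of the first `i` words of the modified Ziv–Merhav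
parsing of `y_1^N` with respect to `x_1^N`: if `L_i < N`, the next word is `y_{L_i+1}^{L_{i+1}}`
with `L_{i+1} = min {N, L_i + Λ_N(T^{L_i} y, x) + 1}`. Once `L_i = N` the procedure has terminated
and the sequence stays constant. -/
noncomputable def parseEnd (N : ℕ) (y x : ℕ → A) : ℕ → ℕ
  | 0 => 0
  | i + 1 => min N (parseEnd N y x i + matchLength N (shift^[parseEnd N y x i] y) x + 1)

/-- The number `c_N(y|x)` of words of the parsing: the first `i` with `L_i = N`. -/
noncomputable def wordCount (N : ℕ) (y x : ℕ → A) : ℕ :=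
  sInf {i : ℕ | parseEnd N y x i = N}

/-- The modified Ziv–Merhav estimator `Q_N(y, x) = c_N ln N / (N - c_N)`, infinite if
`c_N = N`. -/
noncomputable def mzmEstimator (N : ℕ) (y x : ℕ → A) : EReal :=
  if wordCount N y x = N then ⊤
  else (((wordCount N y x : ℝ) * Real.log N / ((N : ℝ) - wordCount N y x) : ℝ) : EReal)

/-! ### Cylinder probabilities and supports -/

variable [MeasurableSpace A]

/-- The probability `P[a]` of the cylinder of the word `a`. -/
noncomputable def wordProb (P : Measure (ℕ → A)) {n : ℕ} (a : Fin n → A) : ℝ :=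
  P.real (wordCylinder a)

/-- `supp P_n`, the words of length `n` with positive probability. -/
def wordSupport (P : Measure (ℕ → A)) (n : ℕ) : Set (Fin n → A) := {a | 0 < wordProb P a}

/-- `supp P`, the sequences all of whose prefixes have positive probability. -/
def seqSupport (P : Measure (ℕ → A)) : Set (ℕ → A) := {x | ∀ n, 0 < wordProb P (firstWord x n)}

/-! ### Decoupling and decay conditions -/

/-- Upper decoupling (UD). -/
def UpperDecoupled (P : Measure (ℕ → A)) : Prop :=
  ∃ (k : ℕ → ℝ) (τ : ℕ → ℕ), (∀ n, 0 ≤ k n) ∧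
    (k =o[atTop] fun n => (n : ℝ)) ∧ ((fun n => (τ n : ℝ)) =o[atTop] fun n => (n : ℝ)) ∧
    ∀ n, 1 ≤ n → ∀ a ∈ wordSupport P n, ∀ ξ ∈ wordSupport P (τ n),
      ∀ m, 1 ≤ m → ∀ b ∈ wordSupport P m,
        wordProb P (Fin.append (Fin.append a ξ) b) ≤ Real.exp (k n) * (wordProb P a * wordProb P b)

/-- Selective lower decoupling (SLD). -/
def SelectivelyLowerDecoupled (P : Measure (ℕ → A)) : Prop :=
  ∃ (k : ℕ → ℝ) (τ : ℕ → ℕ), (∀ n, 0 ≤ k n) ∧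
    (k =o[atTop] fun n => (n : ℝ)) ∧ ((fun n => (τ n : ℝ)) =o[atTop] fun n => (n : ℝ)) ∧
    ∀ n, 1 ≤ n → ∀ a ∈ wordSupport P n, ∀ m, 1 ≤ m → ∀ b ∈ wordSupport P m,
      ∃ l ≤ τ n, ∃ ξ ∈ wordSupport P l,
        Real.exp (-k n) * (wordProb P a * wordProb P b) ≤
          wordProb P (Fin.append (Fin.append a ξ) b)

/-- Slow enough decay (SE). -/
def DecaysSlowlyEnough (P : Measure (ℕ → A)) : Prop :=
  ∃ β γ : ℝ, 1 ≤ β ∧ γ < 0 ∧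
    ∀ n : ℕ, 1 ≤ n → ∀ a ∈ wordSupport P n, Real.exp (γ * (n : ℝ) ^ β) ≤ wordProb P a

open Classical in
/-- The cross-entropic pressure
`q̄(α) = limsup_n (1/n) ln ∑_{a ∈ supp P_n} P[a]^{-α} Q[a]`, with values in `[-∞, ∞]` and
`ln 0 = -∞`. -/
noncomputable def pressure [Fintype A] (P Q : Measure (ℕ → A)) (α : ℝ) : EReal :=
  limsup (fun n : ℕ =>
    ENNReal.log (ENNReal.ofReal
      (∑ a : Fin n → A with a ∈ wordSupport P n, wordProb P a ^ (-α) * wordProb Q a)) / (n : EReal))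
    atTop

/-- Nondegeneracy (ND) of the pair `(P, Q)`. -/
def Nondegenerate [Fintype A] (P Q : Measure (ℕ → A)) : Prop := pressure P Q (-1) < 0

/-! ### One-sided derivatives and subdifferential at the origin -/

/-- `D` is the (possibly infinite) left derivative of `f` at `0`. -/
def HasLeftDerivAtZero (f : ℝ → EReal) (D : EReal) : Prop :=
  Tendsto (fun α : ℝ => (f α - f 0) / (α : EReal)) (𝓝[<] 0) (𝓝 D)

/-- `D` is the (possibly infinite) right derivative of `f` at `0`. -/
def HasRightDerivAtZero (f : ℝ → EReal) (D : EReal) : Prop :=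
  Tendsto (fun α : ℝ => (f α - f 0) / (α : EReal)) (𝓝[>] 0) (𝓝 D)

/-- The subdifferential of `f` at `0`: the slopes of the affine minorants exact at `0`. -/
def subdiffAtZero (f : ℝ → EReal) : Set ℝ :=
  {s | ∀ α : ℝ, f 0 + ((s * α : ℝ) : EReal) ≤ f α}

end ZivMerhav

open ZivMerhav

namespace ZivMerhav

/-! ### Words, shifts and prefix-determined sets -/

section Basics

variable {A : Type*}

/-! Both bounds are union bounds with Borel–Cantelli: the parsing cuts `y` into words that are seen,
or unseen, in `x`, and upper decoupling of `Q` makes the probability of a chain of such words nearly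
a product. The pressure enters through the exponential bound on `crossSum` at one parameter `-β` or
`α`.

Pressure. Since `supp Q ⊆ supp P`, the sums at `0` equal `1`, and Jensen's inequality with weights
`Q[a]` shows that the pressure is star-shaped about the origin (`pressure_mul_le`). This makes the
difference quotients at `0` monotone on each side, which gives the one-sided derivatives and the
subdifferential (`exists_oneSided_derivs`). A slope `s` below the left derivative comes with some `β
∈ (0, 1]` with pressure at `-β` below `-βs`; a slope `s` above the right derivative comes with some
`α > 0` with pressure at `α` below `sα`.

Lower bound (`ae_eventually_le_mzmEstimator`). Every parsing word but the last is, up to its final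
letter, a word seen in `x`. By Markov's inequality, for typical `x` the `Q`-measure of the words of
length `n` seen in the first `N` letters is about `N^β exp(tn)` at most, with `t < -βs`. Cutting
from each word a short end to serve as decoupling gap leaves it seen, so `c` words covering nearly
`N` letters have probability about `N^(βc) exp(tN)` at most, which is summable when `c ln N ≤ sN`.

Upper bound (`ae_eventually_mzmEstimator_le`). Every parsing word but the last is unseen in `x`.
Selective lower decoupling of `P` makes all words of logarithmic length and probability at least
`N^(-(1-δ))` appear early, so each parsing word is `P`-improbable, and by Chernoff's inequality
improbable words of length `l` have `Q`-measure about `N^(-α) exp(tl)` at most. A truncated unseen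
word need not be unseen, so gaps cannot be cut from the words themselves; every second word serves
as a gap instead, and the parity class of smaller total length is kept. This halves both the number
of words and the length budget, so the exponent is still negative. Words too short to be gaps are
few, because few positions start an improbable short word.

Nondegeneracy bounds all match lengths by a multiple of `ln N`. Almost sure statements about `x` are
proved along dyadic scales `2^m`, with `m = Nat.log 2 N`. -/

lemma shift_iterate_apply (p : ℕ) (y : ℕ → A) (i : ℕ) : shift^[p] y i = y (p + i) := by
  induction p generalizing y with
  | zero => simp
  | succ p ih =>
    rw [Function.iterate_succ_apply, ih, shift]
    congr 1; omega

lemma shift_iterate_shift_iterate (p q : ℕ) (y : ℕ → A) :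
    shift^[q] (shift^[p] y) = shift^[p + q] y := by
  rw [Nat.add_comm, Function.iterate_add_apply]

lemma firstWord_eq_iff {n : ℕ} {y : ℕ → A} {a : Fin n → A} :
    firstWord y n = a ↔ ∀ i : Fin n, y i = a i := by
  simp [funext_iff, firstWord]

lemma firstWord_shift_eq_iff {n p : ℕ} {y : ℕ → A} {a : Fin n → A} :
    firstWord (shift^[p] y) n = a ↔ ∀ i : Fin n, y (p + i) = a i := by
  simp [firstWord_eq_iff, shift_iterate_apply]

lemma firstWord_append_iff {n m : ℕ} {y : ℕ → A} {a : Fin n → A} {b : Fin m → A} :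
    firstWord y (n + m) = Fin.append a b ↔
      firstWord y n = a ∧ firstWord (shift^[n] y) m = b := by
  rw [firstWord_eq_iff, firstWord_eq_iff, firstWord_shift_eq_iff, Fin.forall_fin_add]
  simp

/-- The set `E` is determined by a finite prefix. -/
def PrefixDetermined (E : Set (ℕ → A)) : Prop :=
  ∃ m, ∀ y y' : ℕ → A, (∀ i < m, y i = y' i) → y ∈ E → y' ∈ E

lemma PrefixDetermined.univ : PrefixDetermined (Set.univ : Set (ℕ → A)) :=
  ⟨0, fun _ _ _ _ => trivial⟩

lemma PrefixDetermined.inter {E F : Set (ℕ → A)} (hE : PrefixDetermined E)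
    (hF : PrefixDetermined F) : PrefixDetermined (E ∩ F) := by
  obtain ⟨m, hm⟩ := hE
  obtain ⟨k, hk⟩ := hF
  refine ⟨max m k, fun y y' h hy => ⟨hm y y' (fun i hi => h i ?_) hy.1,
    hk y y' (fun i hi => h i ?_) hy.2⟩⟩ <;> omega

lemma PrefixDetermined.biUnion {ι : Type*} (s : Finset ι) {E : ι → Set (ℕ → A)}
    (hE : ∀ i ∈ s, PrefixDetermined (E i)) : PrefixDetermined (⋃ i ∈ s, E i) := by
  choose! m hm using hE
  refine ⟨s.sup m, fun y y' h hy => ?_⟩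
  simp only [Set.mem_iUnion] at hy ⊢
  obtain ⟨i, hi, hy⟩ := hy
  exact ⟨i, hi, hm i hi y y' (fun j hj => h j (lt_of_lt_of_le hj (Finset.le_sup hi))) hy⟩

lemma PrefixDetermined.preimage_shift {E : Set (ℕ → A)} (hE : PrefixDetermined E) (p : ℕ) :
    PrefixDetermined (shift^[p] ⁻¹' E) := by
  obtain ⟨m, hm⟩ := hE
  refine ⟨p + m, fun y y' h hy => hm _ _ (fun i hi => ?_) hy⟩
  simp only [shift_iterate_apply]
  exact h _ (by omega)

lemma PrefixDetermined.firstWord_mem {n : ℕ} (B : Set (Fin n → A)) :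
    PrefixDetermined {y : ℕ → A | firstWord y n ∈ B} := by
  refine ⟨n, fun y y' h hy => ?_⟩
  have : firstWord y' n = firstWord y n := by
    ext i; exact (h i i.2).symm
  simpa [this] using hy

/-- One spare letter keeps the words nonempty, as the decoupling conditions demand. -/
lemma PrefixDetermined.exists_words {E : Set (ℕ → A)} (hE : PrefixDetermined E) :
    ∃ m, 1 ≤ m ∧ ∃ B : Set (Fin m → A), E = {y | firstWord y m ∈ B} := by
  obtain ⟨m, hm⟩ := hE
  refine ⟨m + 1, by omega, (fun y => firstWord y (m + 1)) '' E, ?_⟩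
  ext y
  refine ⟨fun hy => ⟨y, hy, rfl⟩, ?_⟩
  rintro ⟨y', hy', h⟩
  exact hm y' y (fun i hi => congrFun h ⟨i, by omega⟩) hy'

variable [MeasurableSpace A]

lemma measurable_shift_iterate (p : ℕ) : Measurable (shift^[p] : (ℕ → A) → ℕ → A) := by
  have : Measurable (shift : (ℕ → A) → ℕ → A) :=
    measurable_pi_lambda _ fun k => measurable_pi_apply (k + 1)
  exact this.iterate p

lemma measurable_firstWord (n : ℕ) : Measurable (fun y : ℕ → A => firstWord y n) :=
  measurable_pi_lambda _ fun i => measurable_pi_apply (i : ℕ)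

lemma wordProb_nonneg (Q : Measure (ℕ → A)) {n : ℕ} (a : Fin n → A) : 0 ≤ wordProb Q a :=
  measureReal_nonneg

lemma wordProb_le_one (Q : Measure (ℕ → A)) [IsProbabilityMeasure Q] {n : ℕ} (a : Fin n → A) :
    wordProb Q a ≤ 1 := measureReal_le_one

lemma real_preimage_shift {Q : Measure (ℕ → A)} (hQ : MeasurePreserving shift Q Q) (p : ℕ)
    {E : Set (ℕ → A)} (hE : MeasurableSet E) : Q.real (shift^[p] ⁻¹' E) = Q.real E :=
  (hQ.iterate p).measureReal_preimage hE.nullMeasurableSet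

variable [Fintype A] [DiscreteMeasurableSpace A]

lemma PrefixDetermined.measurableSet {E : Set (ℕ → A)} (hE : PrefixDetermined E) :
    MeasurableSet E := by
  obtain ⟨m, -, B, rfl⟩ := hE.exists_words
  exact measurable_firstWord m (Set.toFinite B).measurableSet

lemma real_eq_sum_firstWord (Q : Measure (ℕ → A)) [IsProbabilityMeasure Q] (n : ℕ)
    (B : Set (Fin n → A)) (E : Set (ℕ → A)) [DecidablePred (· ∈ B)] :
    Q.real ({y | firstWord y n ∈ B} ∩ E) =
      ∑ a : Fin n → A with a ∈ B, Q.real (wordCylinder a ∩ E) := by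
  have h := sum_measureReal_preimage_singleton (μ := Q.restrict E)
    (Finset.univ.filter (· ∈ B)) (f := fun y : ℕ → A => firstWord y n)
    (fun b _ => measurable_firstWord n (measurableSet_singleton b))
  have h2 : ∀ b : Fin n → A, (Q.restrict E).real ((fun y => firstWord y n) ⁻¹' {b}) =
      Q.real (wordCylinder b ∩ E) := fun b =>
    measureReal_restrict_apply (measurable_firstWord n (measurableSet_singleton b))
  simp only [h2] at h
  rw [h, measureReal_restrict_apply (measurable_firstWord n (Finset.measurableSet _))]
  congr 2
  ext y; simp

lemma real_firstWord_mem (Q : Measure (ℕ → A)) [IsProbabilityMeasure Q] (n : ℕ)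
    (B : Set (Fin n → A)) [DecidablePred (· ∈ B)] :
    Q.real {y | firstWord y n ∈ B} = ∑ a : Fin n → A with a ∈ B, wordProb Q a := by
  have := real_eq_sum_firstWord Q n B Set.univ
  simpa [wordProb] using this

lemma measurableSet_wordCylinder {n : ℕ} (a : Fin n → A) : MeasurableSet (wordCylinder a) :=
  measurable_firstWord n (measurableSet_singleton a)

end Basics

/-! ### Decoupling of prefix-determined events -/

lemma exists_linear_bound {k : ℕ → ℝ} (hk : k =o[atTop] fun n => (n : ℝ)) {ε : ℝ} (hε : 0 < ε) :
    ∃ C : ℝ, 0 ≤ C ∧ ∀ n, k n ≤ ε * n + C := by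
  have h := hk.def hε
  obtain ⟨n₀, hn₀⟩ := eventually_atTop.1 h
  refine ⟨∑ i ∈ Finset.range n₀, |k i|, Finset.sum_nonneg fun _ _ => abs_nonneg _, fun n => ?_⟩
  by_cases hn : n < n₀
  · have h1 : |k n| ≤ ∑ i ∈ Finset.range n₀, |k i| :=
      Finset.single_le_sum (f := fun i => |k i|) (fun _ _ => abs_nonneg _) (Finset.mem_range.2 hn)
    have h2 : 0 ≤ ε * n := by positivity
    linarith [le_abs_self (k n)]
  · have h1 := hn₀ n (by omega)
    have h2 : 0 ≤ ∑ i ∈ Finset.range n₀, |k i| := Finset.sum_nonneg fun _ _ => abs_nonneg _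
    simp only [Real.norm_eq_abs, Nat.abs_cast] at h1
    linarith [le_abs_self (k n)]

section Decoupling

variable {A : Type*} [Fintype A] [MeasurableSpace A] [DiscreteMeasurableSpace A]

/-- Removes the support restrictions: if one of the three factors has probability zero, shift
invariance makes the concatenation null as well. -/
lemma UpperDecoupled.wordProb_append_le {Q : Measure (ℕ → A)} [IsProbabilityMeasure Q]
    (hinv : MeasurePreserving shift Q Q) {k : ℝ} {n t m : ℕ}
    (h : ∀ a ∈ wordSupport Q n, ∀ ξ ∈ wordSupport Q t, ∀ b ∈ wordSupport Q m,
      wordProb Q (Fin.append (Fin.append a ξ) b) ≤ Real.exp k * (wordProb Q a * wordProb Q b))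
    (a : Fin n → A) (ξ : Fin t → A) (b : Fin m → A) :
    wordProb Q (Fin.append (Fin.append a ξ) b) ≤
      Real.exp k * (wordProb Q a * wordProb Q b) := by
  have hR : 0 ≤ Real.exp k * (wordProb Q a * wordProb Q b) :=
    mul_nonneg (Real.exp_pos _).le (mul_nonneg (wordProb_nonneg Q a) (wordProb_nonneg Q b))
  have key : ∀ {l p : ℕ} (c : Fin l → A), ¬ c ∈ wordSupport Q l →
      wordCylinder (Fin.append (Fin.append a ξ) b) ⊆ shift^[p] ⁻¹' wordCylinder c →
      wordProb Q (Fin.append (Fin.append a ξ) b) ≤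
        Real.exp k * (wordProb Q a * wordProb Q b) := by
    intro l p c hc hsub
    have h1 : wordProb Q (Fin.append (Fin.append a ξ) b) ≤ wordProb Q c := by
      unfold wordProb
      rw [← real_preimage_shift hinv p (measurableSet_wordCylinder c)]
      exact measureReal_mono hsub
    have h2 : wordProb Q c ≤ 0 := not_lt.1 hc
    linarith
  by_cases ha : a ∈ wordSupport Q n
  · by_cases hξ : ξ ∈ wordSupport Q t
    · by_cases hb : b ∈ wordSupport Q m
      · exact h a ha ξ hξ b hb
      · refine key (p := n + t) b hb fun y hy => ?_
        exact (firstWord_append_iff.1 hy).2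
    · refine key (p := n) ξ hξ fun y hy => ?_
      exact (firstWord_append_iff.1 (firstWord_append_iff.1 hy).1).2
  · refine key (p := 0) a ha fun y hy => ?_
    exact (firstWord_append_iff.1 (firstWord_append_iff.1 hy).1).1

open Classical in
/-- Upper decoupling with a fixed gap `t`, for events instead of words. -/
lemma real_inter_shift_le {Q : Measure (ℕ → A)} [IsProbabilityMeasure Q] {k : ℝ} {n t : ℕ}
    (h : ∀ m, 1 ≤ m → ∀ (a : Fin n → A) (ξ : Fin t → A) (b : Fin m → A),
      wordProb Q (Fin.append (Fin.append a ξ) b) ≤ Real.exp k * (wordProb Q a * wordProb Q b))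
    (B : Set (Fin n → A)) {E : Set (ℕ → A)} (hE : PrefixDetermined E) :
    Q.real ({y | firstWord y n ∈ B} ∩ shift^[n + t] ⁻¹' E) ≤
      (Fintype.card A : ℝ) ^ t * Real.exp k * (Q.real {y | firstWord y n ∈ B} * Q.real E) := by
  obtain ⟨m, hm, F, rfl⟩ := hE.exists_words
  have hone : ∀ a : Fin n → A, Q.real (wordCylinder a ∩ shift^[n + t] ⁻¹' {y | firstWord y m ∈ F})
      ≤ ∑ ξ : Fin t → A, ∑ b : Fin m → A with b ∈ F,
        wordProb Q (Fin.append (Fin.append a ξ) b) := by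
    intro a
    have hsub : wordCylinder a ∩ shift^[n + t] ⁻¹' {y | firstWord y m ∈ F} ⊆
        ⋃ ξ ∈ (Finset.univ : Finset (Fin t → A)), ⋃ b ∈ Finset.univ.filter (· ∈ F),
          wordCylinder (Fin.append (Fin.append a ξ) b) := by
      rintro y ⟨hy1, hy2⟩
      simp only [Set.mem_iUnion]
      refine ⟨firstWord (shift^[n] y) t, Finset.mem_univ _, firstWord (shift^[n + t] y) m, ?_, ?_⟩
      · simpa using hy2
      · exact firstWord_append_iff.2 ⟨firstWord_append_iff.2 ⟨hy1, rfl⟩, rfl⟩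
    refine (measureReal_mono hsub (measure_ne_top _ _)).trans ((measureReal_biUnion_finset_le _ _).trans ?_)
    exact Finset.sum_le_sum fun ξ _ => measureReal_biUnion_finset_le _ _
  rw [real_eq_sum_firstWord, real_firstWord_mem, real_firstWord_mem, Finset.sum_mul_sum,
    Finset.mul_sum]
  refine Finset.sum_le_sum fun a _ => (hone a).trans ?_
  calc ∑ ξ : Fin t → A, ∑ b : Fin m → A with b ∈ F, wordProb Q (Fin.append (Fin.append a ξ) b)
      ≤ ∑ _ξ : Fin t → A, ∑ b : Fin m → A with b ∈ F,
          Real.exp k * (wordProb Q a * wordProb Q b) :=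
        Finset.sum_le_sum fun ξ _ => Finset.sum_le_sum fun b _ => h m hm a ξ b
    _ = _ := by
        rw [Finset.sum_const, ← Finset.mul_sum]
        simp [mul_assoc]

/-- Upper decoupling for events, over every gap that is long enough. -/
lemma UpperDecoupled.exists_real_inter_le {Q : Measure (ℕ → A)} [IsProbabilityMeasure Q]
    (hinv : MeasurePreserving shift Q Q) (hQ : UpperDecoupled Q) {ε : ℝ} (hε : 0 < ε) :
    ∃ C : ℝ, 0 ≤ C ∧ ∀ n d : ℕ, ε * n + C ≤ d → ∀ (B : Set (Fin n → A)) (E : Set (ℕ → A)),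
      PrefixDetermined E →
      Q.real ({y | firstWord y n ∈ B} ∩ shift^[n + d] ⁻¹' E) ≤
        Real.exp (ε * n + C) * (Q.real {y | firstWord y n ∈ B} * Q.real E) := by
  obtain ⟨k, τ, hk0, hk, hτ, h⟩ := hQ
  set R : ℝ := Real.log (Fintype.card A) with hR
  have hcard : 0 < Fintype.card A := by
    have : Nonempty A := by
      by_contra hA
      have : IsEmpty A := not_nonempty_iff.1 hA
      have h0 : (Set.univ : Set (ℕ → A)) = ∅ := by
        ext y; exact (IsEmpty.false (y 0)).elim
      have h1 := measure_univ (μ := Q)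
      rw [h0] at h1; simp at h1
    exact Fintype.card_pos
  have hR0 : 0 ≤ R := Real.log_natCast_nonneg _
  -- Summing over all gap words costs `|A|^(τ n) = exp (R * τ n)`, still subexponential in `n`.
  obtain ⟨C₁, hC₁, h₁⟩ := exists_linear_bound (hk.add (hτ.const_mul_left R)) hε
  obtain ⟨C₂, hC₂, h₂⟩ := exists_linear_bound hτ hε
  refine ⟨C₁ + C₂, by positivity, fun n d hd B E hE => ?_⟩
  -- Decoupling says nothing about the empty word; there the first event is everything or empty.
  by_cases hn : n = 0
  · subst hn
    by_cases hB : ∀ y : ℕ → A, firstWord y 0 ∈ B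
    · have : {y : ℕ → A | firstWord y 0 ∈ B} = Set.univ := by ext y; simp [hB y]
      rw [this]
      rw [Set.univ_inter, probReal_univ, one_mul]
      rw [real_preimage_shift hinv _ hE.measurableSet]
      exact le_mul_of_one_le_left measureReal_nonneg (Real.one_le_exp (by positivity))
    · have : {y : ℕ → A | firstWord y 0 ∈ B} = ∅ := by
        ext y
        simp only [Set.mem_ofPred_eq, Set.mem_empty_iff_false, iff_false]
        intro hy
        exact hB fun y' => by rwa [Subsingleton.elim (firstWord y' 0) (firstWord y 0)]
      rw [this]; simp
  · have hτd : τ n ≤ d := by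
      have := h₂ n
      have : (τ n : ℝ) ≤ d := by linarith
      exact_mod_cast this
    -- The excess of the gap over `τ n` is absorbed by shifting the second event.
    obtain ⟨e, rfl⟩ := Nat.exists_eq_add_of_le hτd
    have key := real_inter_shift_le (Q := Q) (k := k n) (n := n) (t := τ n)
      (fun m hm => UpperDecoupled.wordProb_append_le hinv
        fun a ha ξ hξ b hb => h n (by omega) a ha ξ hξ m hm b hb) B (hE.preimage_shift e)
    have e1 : shift^[n + τ n] ⁻¹' (shift^[e] ⁻¹' E) = shift^[n + (τ n + e)] ⁻¹' E := by
      ext y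
      simp only [Set.mem_preimage, shift_iterate_shift_iterate, Nat.add_assoc]
    rw [e1, real_preimage_shift hinv _ hE.measurableSet] at key
    refine key.trans (mul_le_mul_of_nonneg_right ?_
      (mul_nonneg measureReal_nonneg measureReal_nonneg))
    have e2 : (Fintype.card A : ℝ) ^ τ n = Real.exp (R * τ n) := by
      rw [mul_comm, Real.exp_nat_mul, hR, Real.exp_log (by exact_mod_cast hcard)]
    rw [e2, ← Real.exp_add]
    refine Real.exp_le_exp.2 ?_
    have := h₁ n
    linarith

end Decoupling

/-! ### Supports -/

section Support

variable {A : Type*} [Fintype A] [MeasurableSpace A] [DiscreteMeasurableSpace A]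

open Classical in
lemma ae_wordProb_firstWord_pos (Q : Measure (ℕ → A)) [IsProbabilityMeasure Q] :
    ∀ᵐ y ∂Q, y ∈ seqSupport Q := by
  refine ae_all_iff.2 fun n => ?_
  have h := real_firstWord_mem Q n {a | wordProb Q a = 0}
  have h0 : Q.real {y | firstWord y n ∈ {a | wordProb Q a = 0}} = 0 := by
    rw [h]
    exact Finset.sum_eq_zero fun a ha => by simpa using ha
  rw [measureReal_eq_zero_iff] at h0
  filter_upwards [measure_eq_zero_iff_ae_notMem.1 h0] with y hy
  exact lt_of_le_of_ne (wordProb_nonneg Q _) fun h' => hy h'.symm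

/-- A cylinder of positive `Q`-measure contains a point of `supp Q`, because `supp Q` has full
measure; that point lies in `supp P`. -/
lemma wordProb_pos_of_seqSupport_subset {P Q : Measure (ℕ → A)} [IsProbabilityMeasure Q]
    (hsupp : seqSupport Q ⊆ seqSupport P) {n : ℕ} {a : Fin n → A} (ha : 0 < wordProb Q a) :
    0 < wordProb P a := by
  have h1 : Q (wordCylinder a) ≠ 0 := fun h => by
    simp [wordProb, Measure.real, h] at ha
  obtain ⟨y, hy, hy'⟩ := (frequently_ae_mem_iff.2 h1).and_eventually
    (ae_wordProb_firstWord_pos Q) |>.exists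
  have := hsupp hy' n
  rwa [show firstWord y n = a from hy] at this

end Support

/-! ### The pressure -/

section Pressure

variable {A : Type*} [Fintype A] [MeasurableSpace A]

open Classical in
/-- The sum `∑_{a ∈ supp P_n} P[a]^{-α} Q[a]` in the definition of the pressure. -/
noncomputable def crossSum (P Q : Measure (ℕ → A)) (n : ℕ) (α : ℝ) : ℝ :=
  ∑ a : Fin n → A with a ∈ wordSupport P n, wordProb P a ^ (-α) * wordProb Q a

lemma pressure_eq (P Q : Measure (ℕ → A)) (α : ℝ) :
    pressure P Q α = limsup (fun n : ℕ =>
      ENNReal.log (ENNReal.ofReal (crossSum P Q n α)) / (n : EReal)) atTop := rfl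

lemma crossSum_nonneg (P Q : Measure (ℕ → A)) (n : ℕ) (α : ℝ) : 0 ≤ crossSum P Q n α :=
  Finset.sum_nonneg fun a _ =>
    mul_nonneg (Real.rpow_nonneg (wordProb_nonneg P a) _) (wordProb_nonneg Q a)

lemma log_crossSum_le_iff {P Q : Measure (ℕ → A)} {n : ℕ} {α r : ℝ} :
    ENNReal.log (ENNReal.ofReal (crossSum P Q n α)) ≤ (r : EReal) ↔
      crossSum P Q n α ≤ Real.exp r := by
  rw [ENNReal.log_ofReal]
  split_ifs with h
  · simp only [bot_le, true_iff]
    exact h.trans (Real.exp_pos _).le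
  · rw [EReal.coe_le_coe_iff, Real.log_le_iff_le_exp (not_le.1 h)]

/-- The limsup gives the bound for large `n`; the constant `C` pays for the finitely many other
lengths. All later estimates see the pressure only through this bound. -/
lemma exists_crossSum_le {P Q : Measure (ℕ → A)} {α t : ℝ} (h : pressure P Q α < t) :
    ∃ C : ℝ, 0 ≤ C ∧ ∀ n : ℕ, crossSum P Q n α ≤ Real.exp (t * n + C) := by
  rw [pressure_eq] at h
  have h1 := eventually_lt_of_limsup_lt h
  obtain ⟨n₀, hn₀⟩ := eventually_atTop.1 (h1.and (eventually_ge_atTop 1))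
  refine ⟨∑ n ∈ Finset.range n₀, |Real.log (crossSum P Q n α) - t * n|,
    Finset.sum_nonneg fun _ _ => abs_nonneg _, fun n => ?_⟩
  by_cases hn : n < n₀
  · rcases (crossSum_nonneg P Q n α).eq_or_lt with h0 | h0
    · rw [← h0]; exact (Real.exp_pos _).le
    · rw [← Real.log_le_iff_le_exp h0]
      have := Finset.single_le_sum
        (f := fun n : ℕ => |Real.log (crossSum P Q n α) - t * n|)
        (fun _ _ => abs_nonneg _) (Finset.mem_range.2 hn)
      have h2 := le_abs_self (Real.log (crossSum P Q n α) - t * n)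
      linarith
  · obtain ⟨h2, h3⟩ := hn₀ n (by omega)
    have hpos : (0 : EReal) < (n : EReal) := by exact_mod_cast h3
    rw [EReal.div_lt_iff hpos (EReal.natCast_ne_top n)] at h2
    have h4 : ENNReal.log (ENNReal.ofReal (crossSum P Q n α)) ≤ ((t * n : ℝ) : EReal) := by
      refine h2.le.trans_eq ?_
      simp
    refine (log_crossSum_le_iff.1 h4).trans (Real.exp_le_exp.2 ?_)
    have : 0 ≤ ∑ n ∈ Finset.range n₀, |Real.log (crossSum P Q n α) - t * n| :=
      Finset.sum_nonneg fun _ _ => abs_nonneg _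
    linarith

lemma pressure_le {P Q : Measure (ℕ → A)} {α t C : ℝ}
    (h : ∀ n : ℕ, crossSum P Q n α ≤ Real.exp (t * n + C)) : pressure P Q α ≤ t := by
  have hlim : Tendsto (fun n : ℕ => ((t + C / n : ℝ) : EReal)) atTop (𝓝 (t : EReal)) := by
    refine (continuous_coe_real_ereal.tendsto _).comp ?_
    simpa using tendsto_const_nhds.add (tendsto_const_div_atTop_nhds_zero_nat C)
  rw [pressure_eq, ← hlim.limsup_eq]
  refine limsup_le_limsup ?_
  filter_upwards [eventually_ge_atTop 1] with n hn
  have hpos : (0 : EReal) < (n : EReal) := by exact_mod_cast hn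
  rw [EReal.div_le_iff_le_mul hpos (EReal.natCast_ne_top n)]
  have h1 := log_crossSum_le_iff.2 (h n)
  refine h1.trans_eq ?_
  have hn' : (n : ℝ) ≠ 0 := by positivity
  have : t * n + C = n * (t + C / n) := by field_simp
  rw [this, EReal.coe_mul]; simp

variable [DiscreteMeasurableSpace A]

open Classical in
lemma sum_wordProb_eq_one {P Q : Measure (ℕ → A)} [IsProbabilityMeasure Q]
    (hsupp : seqSupport Q ⊆ seqSupport P) (n : ℕ) :
    ∑ a : Fin n → A with a ∈ wordSupport P n, wordProb Q a = 1 := by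
  have h := real_firstWord_mem Q n Set.univ
  simp only [Set.mem_univ, Set.ofPred_true, probReal_univ, Finset.filter_true] at h
  rw [h]
  refine Finset.sum_subset (Finset.subset_univ _) fun a _ ha => ?_
  have ha' : a ∉ wordSupport P n := by simpa using ha
  by_contra h0
  exact ha' (wordProb_pos_of_seqSupport_subset hsupp
    (lt_of_le_of_ne (wordProb_nonneg Q a) (Ne.symm h0)))

lemma crossSum_zero {P Q : Measure (ℕ → A)} [IsProbabilityMeasure Q]
    (hsupp : seqSupport Q ⊆ seqSupport P) (n : ℕ) : crossSum P Q n 0 = 1 := by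
  simp [crossSum, sum_wordProb_eq_one hsupp n]

lemma pressure_zero {P Q : Measure (ℕ → A)} [IsProbabilityMeasure Q]
    (hsupp : seqSupport Q ⊆ seqSupport P) : pressure P Q 0 = 0 := by
  simp [pressure_eq, crossSum_zero hsupp, EReal.zero_div]

/-- Jensen's inequality for the power `r⁻¹ ≥ 1`; the weights `Q[a]` over `supp P_n` sum to one by
the support inclusion. -/
lemma crossSum_mul_le {P Q : Measure (ℕ → A)} [IsProbabilityMeasure Q]
    (hsupp : seqSupport Q ⊆ seqSupport P) (n : ℕ) (α : ℝ) {r : ℝ} (hr0 : 0 < r) (hr1 : r ≤ 1) :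
    crossSum P Q n (r * α) ≤ crossSum P Q n α ^ r := by
  classical
  have h := Real.rpow_arith_mean_le_arith_mean_rpow
    (Finset.univ.filter (fun a : Fin n → A => a ∈ wordSupport P n))
    (fun a => wordProb Q a) (fun a => wordProb P a ^ (-(r * α)))
    (fun a _ => wordProb_nonneg Q a) (sum_wordProb_eq_one hsupp n)
    (fun a _ => Real.rpow_nonneg (wordProb_nonneg P a) _) ((one_le_inv₀ hr0).2 hr1)
  have e1 : ∑ a : Fin n → A with a ∈ wordSupport P n,
      wordProb Q a * (wordProb P a ^ (-(r * α))) ^ r⁻¹ = crossSum P Q n α := by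
    unfold crossSum
    refine Finset.sum_congr (by ext; simp) fun a _ => ?_
    rw [← Real.rpow_mul (wordProb_nonneg P a), mul_comm]
    congr 2; field_simp
  have e2 : ∑ a : Fin n → A with a ∈ wordSupport P n,
      wordProb Q a * wordProb P a ^ (-(r * α)) = crossSum P Q n (r * α) := by
    unfold crossSum
    exact Finset.sum_congr (by ext; simp) fun a _ => mul_comm _ _
  rw [e1, e2] at h
  have h2 := Real.rpow_le_rpow (Real.rpow_nonneg (crossSum_nonneg P Q n _) _) h hr0.le
  rwa [← Real.rpow_mul (crossSum_nonneg P Q n _), inv_mul_cancel₀ hr0.ne', Real.rpow_one] at h2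

lemma pressure_mul_le {P Q : Measure (ℕ → A)} [IsProbabilityMeasure Q]
    (hsupp : seqSupport Q ⊆ seqSupport P) {α t r : ℝ} (hr0 : 0 < r) (hr1 : r ≤ 1)
    (h : pressure P Q α < t) : pressure P Q (r * α) ≤ (r * t : ℝ) := by
  obtain ⟨C, -, hC⟩ := exists_crossSum_le h
  refine pressure_le (C := r * C) fun n => (crossSum_mul_le hsupp n α hr0 hr1).trans ?_
  refine (Real.rpow_le_rpow (crossSum_nonneg P Q n _) (hC n) hr0.le).trans_eq ?_
  rw [← Real.exp_mul]
  congr 1; ring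

lemma pressure_nonneg {P Q : Measure (ℕ → A)} [IsProbabilityMeasure P] [IsProbabilityMeasure Q]
    (hsupp : seqSupport Q ⊆ seqSupport P) {α : ℝ} (hα : 0 ≤ α) : 0 ≤ pressure P Q α := by
  classical
  refine EReal.le_of_forall_lt_iff_le.1 fun t ht => ?_
  obtain ⟨C, -, hC⟩ := exists_crossSum_le ht
  rw [EReal.coe_nonneg]
  by_contra hneg
  have hlow : ∀ n : ℕ, 0 ≤ t * n + C := by
    intro n
    rw [← Real.one_le_exp_iff]
    refine le_trans ?_ (hC n)
    rw [← sum_wordProb_eq_one hsupp n]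
    refine Finset.sum_le_sum fun a ha => le_mul_of_one_le_left (wordProb_nonneg Q a) ?_
    have ha' : 0 < wordProb P a := (Finset.mem_filter.1 ha).2
    exact Real.one_le_rpow_of_pos_of_le_one_of_nonpos ha' (wordProb_le_one P a) (by linarith)
  obtain ⟨n, hn⟩ := exists_nat_gt (C / (-t))
  rw [div_lt_iff₀ (by linarith)] at hn
  have := hlow n
  linarith

end Pressure

/-! ### One-sided derivatives at the origin of star-shaped functions -/

section Slopes

lemma coe_lt_div_coe_neg_iff {x : EReal} {s α : ℝ} (hα : α < 0) :
    (s : EReal) < x / (α : EReal) ↔ x < ((s * α : ℝ) : EReal) := by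
  have h1 : x / (α : EReal) = (-x) / ((-α : ℝ) : EReal) := by
    rw [div_eq_mul_inv, div_eq_mul_inv, EReal.coe_neg, EReal.inv_neg, mul_neg,
      neg_mul, neg_neg]
  rw [h1, EReal.lt_div_iff (by exact_mod_cast neg_pos.2 hα) (EReal.coe_ne_top _), ← EReal.coe_mul,
    EReal.lt_neg_comm, ← EReal.coe_neg, mul_neg, neg_neg]

lemma div_coe_lt_coe_iff {x : EReal} {s α : ℝ} (hα : 0 < α) :
    x / (α : EReal) < (s : EReal) ↔ x < ((s * α : ℝ) : EReal) := by
  rw [EReal.div_lt_iff (by exact_mod_cast hα) (EReal.coe_ne_top _), ← EReal.coe_mul]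

/-- Star-shapedness compares values only along segments from the origin. That already makes `f α /
α` monotone on each half-line, so the derivatives are its supremum on the left and its infimum on
the right, and slopes strictly beyond them are beaten by a single quotient. Full convexity is not
needed. -/
lemma exists_oneSided_derivs {f : ℝ → EReal} (h0 : f 0 = 0)
    (hstar : ∀ α t r : ℝ, 0 < r → r ≤ 1 → f α < (t : EReal) → f (r * α) ≤ ((r * t : ℝ) : EReal)) :
    ∃ Dm Dp : EReal, HasLeftDerivAtZero f Dm ∧ HasRightDerivAtZero f Dp ∧
      subdiffAtZero f = {s : ℝ | Dm ≤ (s : EReal) ∧ (s : EReal) ≤ Dp} ∧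
      (∀ s : ℝ, (s : EReal) < Dm → ∃ β : ℝ, 0 < β ∧ β ≤ 1 ∧ f (-β) < ((-(β * s) : ℝ) : EReal)) ∧
      ∀ s : ℝ, Dp < (s : EReal) → ∃ α : ℝ, 0 < α ∧ f α < ((s * α : ℝ) : EReal) := by
  set g : ℝ → EReal := fun α => (f α - f 0) / (α : EReal) with hg
  have hgα : ∀ α, g α = f α / (α : EReal) := fun α => by simp [hg, h0]
  have hpos : MonotoneOn g (Set.Ioi 0) := by
    intro a ha b hb hab
    simp only [Set.mem_Ioi] at ha hb
    refine EReal.le_of_forall_lt_iff_le.1 fun s hs => ?_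
    rw [hgα, div_coe_lt_coe_iff hb] at hs
    have h1 := hstar b _ (a / b) (by positivity) ((div_le_one hb).2 hab) hs
    rw [div_mul_cancel₀ _ hb.ne'] at h1
    rw [hgα, EReal.div_le_iff_le_mul (by exact_mod_cast ha) (EReal.coe_ne_top _), ← EReal.coe_mul]
    refine h1.trans_eq ?_
    congr 1; field_simp
  have hneg : MonotoneOn g (Set.Iio 0) := by
    intro a ha b hb hab
    simp only [Set.mem_Iio] at ha hb
    refine EReal.ge_of_forall_gt_iff_ge.1 fun s hs => ?_
    rw [hgα, coe_lt_div_coe_neg_iff ha] at hs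
    have h1 := hstar a _ (b / a) (div_pos_of_neg_of_neg hb ha)
      ((div_le_one_of_neg ha).2 hab) hs
    rw [div_mul_cancel₀ _ ha.ne] at h1
    rw [← not_lt, hgα]
    intro h2
    obtain ⟨u, hu1, hu2⟩ := EReal.lt_iff_exists_real_btwn.1 h2
    rw [← not_le] at hu1
    refine hu1 ?_
    have h3 : f b < ((u * b : ℝ) : EReal) := by
      refine h1.trans_lt ?_
      have e : b / a * (s * a) = s * b := by
        have := ha.ne
        field_simp
      rw [e, EReal.coe_lt_coe_iff]
      have := EReal.coe_lt_coe_iff.1 hu2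
      nlinarith
    exact ((coe_lt_div_coe_neg_iff hb).2 h3).le
  refine ⟨sSup (g '' Set.Iio 0), sInf (g '' Set.Ioi 0), hneg.tendsto_nhdsLT (OrderTop.bddAbove _),
    hpos.tendsto_nhdsGT (OrderBot.bddBelow _), ?_, ?_, ?_⟩
  · ext s
    simp only [subdiffAtZero, h0, zero_add, Set.mem_ofPred_eq, sSup_le_iff, le_sInf_iff,
      Set.forall_mem_image, Set.mem_Iio, Set.mem_Ioi]
    refine ⟨fun h => ⟨fun α hα => ?_, fun α hα => ?_⟩, fun h α => ?_⟩
    · rw [← not_lt, hgα, coe_lt_div_coe_neg_iff hα, not_lt]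
      exact h α
    · rw [← not_lt, hgα, div_coe_lt_coe_iff hα, not_lt]
      exact h α
    · rcases lt_trichotomy α 0 with hα | rfl | hα
      · have := h.1 hα
        rwa [← not_lt, hgα, coe_lt_div_coe_neg_iff hα, not_lt] at this
      · simp [h0]
      · have := h.2 hα
        rwa [← not_lt, hgα, div_coe_lt_coe_iff hα, not_lt] at this
  · intro s hs
    obtain ⟨_, ⟨α, hα, rfl⟩, h1⟩ := lt_sSup_iff.1 hs
    simp only [Set.mem_Iio] at hα
    -- Moving the witness towards `0` only raises the quotient, so `β ≤ 1` can be arranged;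
    -- `real_setOf_seenIn_le` relies on it.
    have hα' : max α (-1) < 0 := max_lt hα (by norm_num)
    have h2 := lt_of_lt_of_le h1 (hneg hα hα' (le_max_left α (-1)))
    rw [hgα, coe_lt_div_coe_neg_iff hα'] at h2
    refine ⟨-max α (-1), by linarith, by linarith [le_max_right α (-1)], ?_⟩
    rw [neg_neg]
    refine h2.trans_eq ?_
    congr 1; ring
  · intro s hs
    obtain ⟨_, ⟨α, hα, rfl⟩, h1⟩ := sInf_lt_iff.1 hs
    rw [hgα, div_coe_lt_coe_iff hα] at h1
    exact ⟨α, hα, h1⟩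

end Slopes

/-! ### The parsing -/

section Parsing

variable {A : Type*}

/-- The word `y_1^l` occurs in `x_1^N`. -/
def SeenIn (N l : ℕ) (y x : ℕ → A) : Prop := ∃ j, j + l ≤ N ∧ ∀ i < l, x (j + i) = y i

lemma SeenIn.mono {N N' l l' : ℕ} {y x : ℕ → A} (h : SeenIn N l y x) (hN : N ≤ N')
    (hl : l' ≤ l) : SeenIn N' l' y x := by
  obtain ⟨j, hj, hx⟩ := h
  exact ⟨j, by omega, fun i hi => hx i (by omega)⟩

lemma SeenIn.le {N l : ℕ} {y x : ℕ → A} (h : SeenIn N l y x) : l ≤ N := by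
  obtain ⟨j, hj, -⟩ := h
  omega

lemma waitingTime_add_le_iff {N l : ℕ} {y x : ℕ → A} :
    waitingTime l y x + l ≤ N + 1 ↔ SeenIn N l y x := by
  constructor
  · intro h
    by_cases hne : ∃ r : ℕ, 1 ≤ r ∧ ∀ i < l, x (r - 1 + i) = y i
    · have hle : waitingTime l y x ≤ ((N + 1 - l : ℕ) : ℕ∞) := by
        rw [ENat.natCast_sub]
        refine (ENat.le_sub_of_add_le_right (ENat.natCast_ne_top l) ?_)
        exact_mod_cast h
      have hlt : waitingTime l y x < ((N + 1 - l + 1 : ℕ) : ℕ∞) :=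
        lt_of_le_of_lt hle (by exact_mod_cast Nat.lt_succ_self _)
      simp only [waitingTime, iInf_lt_iff] at hlt
      obtain ⟨r, ⟨hr1, hr2⟩, hr3⟩ := hlt
      have hr4 : r < N + 1 - l + 1 := by exact_mod_cast hr3
      have hlN : l ≤ N + 1 := by
        have h1 : (l : ℕ∞) ≤ N + 1 := le_trans le_add_self h
        exact_mod_cast h1
      exact ⟨r - 1, by omega, hr2⟩
    · have : waitingTime l y x = ⊤ := by
        simp only [waitingTime, iInf_eq_top]
        intro r hr
        exact (hne ⟨r, hr⟩).elim
      rw [this, top_add, top_le_iff] at h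
      exact absurd h (by exact_mod_cast ENat.natCast_ne_top (N + 1))
  · rintro ⟨j, hj, hx⟩
    have h1 : waitingTime l y x ≤ ((j + 1 : ℕ) : ℕ∞) := by
      unfold waitingTime
      exact iInf₂_le (j + 1) ⟨by omega, by simpa using hx⟩
    calc waitingTime l y x + l ≤ ((j + 1 : ℕ) : ℕ∞) + l := by gcongr
      _ ≤ N + 1 := by
        have : j + 1 + l ≤ N + 1 := by omega
        exact_mod_cast this

lemma matchLength_eq (N : ℕ) (y x : ℕ → A) :
    matchLength N y x = max 1 (sSup {l : ℕ | 1 ≤ l ∧ SeenIn N l y x}) := by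
  simp only [matchLength, waitingTime_add_le_iff]

lemma bddAbove_seenIn (N : ℕ) (y x : ℕ → A) : BddAbove {l : ℕ | 1 ≤ l ∧ SeenIn N l y x} :=
  ⟨N, fun _ hl => hl.2.le⟩

lemma not_seenIn_matchLength_succ (N : ℕ) (y x : ℕ → A) :
    ¬ SeenIn N (matchLength N y x + 1) y x := by
  intro h
  have h1 := le_csSup (bddAbove_seenIn N y x)
    (show matchLength N y x + 1 ∈ {l : ℕ | 1 ≤ l ∧ SeenIn N l y x} from ⟨by omega, h⟩)
  rw [matchLength_eq] at h1
  have := le_max_right 1 (sSup {l : ℕ | 1 ≤ l ∧ SeenIn N l y x})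
  omega

/-- If the first letter does not occur, the match length is `1` by convention and the match is not
genuine; the hypothesis excludes this. -/
lemma seenIn_matchLength {N : ℕ} {y x : ℕ → A} (h : SeenIn N 1 y x) :
    SeenIn N (matchLength N y x) y x := by
  have h1 := Nat.sSup_mem (s := {l : ℕ | 1 ≤ l ∧ SeenIn N l y x}) ⟨1, le_refl 1, h⟩ (bddAbove_seenIn N y x)
  rw [matchLength_eq, max_eq_right h1.1]
  exact h1.2

lemma matchLength_le {N K : ℕ} {y x : ℕ → A} (hK : 1 ≤ K) (h : ∀ l, SeenIn N l y x → l ≤ K) :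
    matchLength N y x ≤ K := by
  rw [matchLength_eq]
  refine max_le hK ?_
  rcases Set.eq_empty_or_nonempty {l : ℕ | 1 ≤ l ∧ SeenIn N l y x} with h0 | h0
  · rw [h0]; simp
  · exact csSup_le h0 fun l hl => h l hl.2

variable (N : ℕ) (y x : ℕ → A)

lemma parseEnd_le (i : ℕ) : parseEnd N y x i ≤ N := by
  cases i with
  | zero => exact Nat.zero_le _
  | succ i => exact min_le_left _ _

lemma min_le_parseEnd (i : ℕ) : min N i ≤ parseEnd N y x i := by
  induction i with
  | zero => simp
  | succ i ih => rw [parseEnd]; omega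

lemma parseEnd_wordCount : parseEnd N y x (wordCount N y x) = N := by
  have hne : {i : ℕ | parseEnd N y x i = N}.Nonempty := by
    refine ⟨N, le_antisymm (parseEnd_le N y x N) ?_⟩
    simpa using min_le_parseEnd N y x N
  exact Nat.sInf_mem hne

lemma wordCount_le : wordCount N y x ≤ N := by
  refine Nat.sInf_le (le_antisymm (parseEnd_le N y x N) ?_)
  simpa using min_le_parseEnd N y x N

variable {N y x}

lemma wordCount_pos (hN : 1 ≤ N) : 1 ≤ wordCount N y x := by
  rcases Nat.eq_zero_or_pos (wordCount N y x) with h | h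
  · have := parseEnd_wordCount N y x
    rw [h, parseEnd] at this
    omega
  · exact h

lemma parseEnd_lt {i : ℕ} (hi : i < wordCount N y x) : parseEnd N y x i < N :=
  lt_of_le_of_ne (parseEnd_le N y x i) fun h => Nat.notMem_of_lt_sInf hi h

/-- Only the last word can be truncated by the `min`. -/
lemma parseEnd_succ {i : ℕ} (hi : i + 1 < wordCount N y x) :
    parseEnd N y x (i + 1) =
      parseEnd N y x i + matchLength N (shift^[parseEnd N y x i] y) x + 1 := by
  have := parseEnd_lt hi
  rw [parseEnd] at this ⊢
  omega

lemma le_parseEnd_pred_add {K : ℕ} (hN : 1 ≤ N)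
    (hK : ∀ p < N, matchLength N (shift^[p] y) x ≤ K) :
    N ≤ parseEnd N y x (wordCount N y x - 1) + K + 1 := by
  have h1 := parseEnd_wordCount N y x
  have h2 := wordCount_pos (y := y) (x := x) hN
  obtain ⟨c, hc⟩ := Nat.exists_eq_add_of_le' h2
  have h3 := hK _ (parseEnd_lt (N := N) (y := y) (x := x) (i := c) (by omega))
  rw [hc, parseEnd] at h1
  rw [hc, Nat.add_sub_cancel]
  omega

end Parsing

/-! ### Probabilities of chains of words -/

section Chains

variable {A : Type*}

/-- The sequences that start with `c` consecutive words of total length `M`, with lengths in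
`[1, K]`, such that a word of length `l` begins a sequence in `G l`. -/
def chainEvent (G : ℕ → Set (ℕ → A)) (K : ℕ) : ℕ → ℕ → Set (ℕ → A)
  | 0, M => {_y | M = 0}
  | c + 1, M => ⋃ l ∈ Finset.Icc 1 K, G l ∩ shift^[l] ⁻¹' chainEvent G K c (M - l)

lemma prefixDetermined_chainEvent {G : ℕ → Set (ℕ → A)} (hG : ∀ l, PrefixDetermined (G l))
    (K c M : ℕ) : PrefixDetermined (chainEvent G K c M) := by
  induction c generalizing M with
  | zero => exact ⟨0, fun _ _ _ h => h⟩
  | succ c ih => exact .biUnion _ fun l _ => (hG l).inter ((ih _).preimage_shift l)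

lemma mem_chainEvent {G : ℕ → Set (ℕ → A)} {K : ℕ} {y : ℕ → A} {L : ℕ → ℕ} (c : ℕ)
    (hL : ∀ i < c, L i < L (i + 1) ∧ L (i + 1) ≤ L i + K ∧
      shift^[L i] y ∈ G (L (i + 1) - L i)) :
    shift^[L 0] y ∈ chainEvent G K c (L c - L 0) ∧ L 0 ≤ L c := by
  induction c generalizing L with
  | zero => exact ⟨Nat.sub_self _, le_refl _⟩
  | succ c ih =>
    obtain ⟨h1, h2, h3⟩ := hL 0 (by omega)
    obtain ⟨h4, h5⟩ := ih (L := fun i => L (i + 1)) fun i hi => hL (i + 1) (by omega)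
    simp only [zero_add] at h1 h2 h3 h4 h5
    refine ⟨?_, by omega⟩
    simp only [chainEvent, Set.mem_iUnion]
    refine ⟨L 1 - L 0, Finset.mem_Icc.2 ⟨by omega, by omega⟩, h3, ?_⟩
    rw [Set.mem_preimage, shift_iterate_shift_iterate,
      show L 0 + (L 1 - L 0) = L 1 by omega,
      show L (c + 1) - L 0 - (L 1 - L 0) = L (c + 1) - L 1 by omega]
    exact h4

/-- The truncated subtraction `M - l` lets a chain overshoot, so `M` acts as a lower bound on the
total length. -/
lemma chainEvent_anti (G : ℕ → Set (ℕ → A)) (K c : ℕ) {M M' : ℕ} (h : M' ≤ M) :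
    chainEvent G K c M ⊆ chainEvent G K c M' := by
  induction c generalizing M M' with
  | zero =>
    intro y hy
    simp only [chainEvent, Set.mem_ofPred_eq] at hy ⊢
    omega
  | succ c ih =>
    exact Set.iUnion₂_mono fun l _ => Set.inter_subset_inter_right _
      (Set.preimage_mono (ih (by omega)))

/-- The sequences that start with `j` words with lengths in `I`, each followed by a gap of length at
least `d₀`, such that a word of length `l` begins a sequence in `G l`; the words have total length
at most `H`, and words and gaps have total length at most `M`. -/
def gapChainEvent (G : ℕ → Set (ℕ → A)) (I : Finset ℕ) (d₀ : ℕ) : ℕ → ℕ → ℕ → Set (ℕ → A)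
  | 0, _, _ => Set.univ
  | j + 1, H, M => ⋃ l ∈ I.filter (· ≤ H), ⋃ d ∈ (Finset.Icc d₀ M).filter (l + · ≤ M),
      G l ∩ shift^[l + d] ⁻¹' gapChainEvent G I d₀ j (H - l) (M - (l + d))

lemma prefixDetermined_gapChainEvent {G : ℕ → Set (ℕ → A)} (hG : ∀ l, PrefixDetermined (G l))
    (I : Finset ℕ) (d₀ j H M : ℕ) : PrefixDetermined (gapChainEvent G I d₀ j H M) := by
  induction j generalizing H M with
  | zero => exact .univ
  | succ j ih =>
    exact .biUnion _ fun l _ => .biUnion _ fun d _ => (hG l).inter ((ih _ _).preimage_shift _)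

lemma mem_gapChainEvent {G : ℕ → Set (ℕ → A)} {I : Finset ℕ} {d₀ : ℕ} {y : ℕ → A} {p l : ℕ → ℕ}
    (j H M : ℕ) (hp : ∀ i < j, l i ∈ I ∧ p i + l i + d₀ ≤ p (i + 1) ∧ shift^[p i] y ∈ G (l i))
    (hH : ∑ i ∈ Finset.range j, l i ≤ H) (hM : p j ≤ p 0 + M) :
    shift^[p 0] y ∈ gapChainEvent G I d₀ j H M ∧ p 0 ≤ p j := by
  induction j generalizing p l H M with
  | zero => exact ⟨trivial, le_refl _⟩
  | succ j ih =>
    obtain ⟨h1, h2, h3⟩ := hp 0 (by omega)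
    rw [Finset.sum_range_succ'] at hH
    have hle : p 1 ≤ p (j + 1) := by
      have hmono : ∀ k ≤ j, p 1 ≤ p (k + 1) := by
        intro k hk
        induction k with
        | zero => exact le_refl _
        | succ k ihk =>
          have := ihk (by omega)
          have := (hp (k + 1) (by omega)).2.1
          omega
      exact hmono j (le_refl j)
    simp only [zero_add] at h2 hM
    obtain ⟨h4, h5⟩ := ih (p := fun i => p (i + 1)) (l := fun i => l (i + 1)) (H - l 0)
      (M - (p 1 - p 0)) (fun i hi => hp (i + 1) (by omega)) (by omega)
      (by simp only [zero_add]; omega)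
    simp only [zero_add] at h4 h5
    refine ⟨?_, by omega⟩
    simp only [gapChainEvent, Set.mem_iUnion, Finset.mem_filter, Finset.mem_Icc]
    refine ⟨l 0, ⟨h1, by omega⟩, p 1 - p 0 - l 0, ⟨⟨by omega, by omega⟩, by omega⟩, h3, ?_⟩
    rw [Set.mem_preimage, shift_iterate_shift_iterate,
      show l 0 + (p 1 - p 0 - l 0) = p 1 - p 0 by omega,
      show p 0 + (p 1 - p 0) = p 1 by omega]
    exact h4

variable [MeasurableSpace A]

lemma measurableSet_setOf_chainEvent {G : (ℕ → A) → ℕ → Set (ℕ → A)}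
    (hG : ∀ l, MeasurableSet {xy : (ℕ → A) × (ℕ → A) | xy.2 ∈ G xy.1 l}) (K c M : ℕ) :
    MeasurableSet {xy : (ℕ → A) × (ℕ → A) | xy.2 ∈ chainEvent (G xy.1) K c M} := by
  induction c generalizing M with
  | zero => exact MeasurableSet.const _
  | succ c ih =>
    have : {xy : (ℕ → A) × (ℕ → A) | xy.2 ∈ chainEvent (G xy.1) K (c + 1) M} =
        ⋃ l ∈ Finset.Icc 1 K, {xy | xy.2 ∈ G xy.1 l} ∩ Prod.map id (shift^[l]) ⁻¹'
          {xy : (ℕ → A) × (ℕ → A) | xy.2 ∈ chainEvent (G xy.1) K c (M - l)} := by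
      ext xy
      simp [chainEvent]
    rw [this]
    exact Finset.measurableSet_biUnion _ fun l _ =>
      (hG l).inter ((measurable_id.prodMap (measurable_shift_iterate l)) (ih _))

/-- Each word contributes at most `K` choices of length and a factor `ρ exp(tl)`. As `t ≤ 0`,
overshooting `M` only helps. -/
lemma real_chainEvent_le {Q : Measure (ℕ → A)} [IsProbabilityMeasure Q] {G : ℕ → Set (ℕ → A)}
    (hG : ∀ l, PrefixDetermined (G l)) {K : ℕ} {ρ t : ℝ} (hρ : 0 ≤ ρ) (ht : t ≤ 0)
    (hdec : ∀ l ∈ Finset.Icc 1 K, ∀ E, PrefixDetermined E →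
      Q.real (G l ∩ shift^[l] ⁻¹' E) ≤ ρ * Real.exp (t * l) * Q.real E) (c M : ℕ) :
    Q.real (chainEvent G K c M) ≤ (K * ρ) ^ c * Real.exp (t * M) := by
  induction c generalizing M with
  | zero =>
    by_cases hM : M = 0
    · simp [hM, measureReal_le_one]
    · simp [chainEvent, hM, Real.exp_nonneg]
  | succ c ih =>
    refine (measureReal_biUnion_finset_le _ _).trans ?_
    have hterm : ∀ l ∈ Finset.Icc 1 K,
        Q.real (G l ∩ shift^[l] ⁻¹' chainEvent G K c (M - l)) ≤
          ρ * ((K * ρ) ^ c * Real.exp (t * M)) := by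
      intro l hl
      refine (hdec l hl _ (prefixDetermined_chainEvent hG K c _)).trans ?_
      refine (mul_le_mul_of_nonneg_left (ih _) (by positivity)).trans ?_
      have hMl : (M : ℝ) ≤ l + (M - l : ℕ) := by exact_mod_cast (by omega : M ≤ l + (M - l))
      have he : Real.exp (t * l) * Real.exp (t * (M - l : ℕ)) ≤ Real.exp (t * M) := by
        rw [← Real.exp_add]
        refine Real.exp_le_exp.2 ?_
        nlinarith
      calc ρ * Real.exp (t * l) * ((K * ρ) ^ c * Real.exp (t * (M - l : ℕ)))
          = ρ * (K * ρ) ^ c * (Real.exp (t * l) * Real.exp (t * (M - l : ℕ))) := by ring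
        _ ≤ ρ * (K * ρ) ^ c * Real.exp (t * M) := by gcongr
        _ = _ := by ring
    refine (Finset.sum_le_sum hterm).trans_eq ?_
    rw [Finset.sum_const, Nat.card_Icc, nsmul_eq_mul]
    push_cast [Nat.add_sub_cancel]
    ring

lemma sum_exp_neg_le {θ : ℝ} (hθ : 0 < θ) (s : Finset ℕ) :
    ∑ d ∈ s, Real.exp (-(θ * d)) ≤ (1 - Real.exp (-θ))⁻¹ := by
  have h1 : Real.exp (-θ) < 1 := by simpa using hθ
  rw [← tsum_geometric_of_lt_one (Real.exp_nonneg _) h1]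
  have h2 : ∀ d : ℕ, Real.exp (-(θ * d)) = Real.exp (-θ) ^ d := fun d => by
    rw [← Real.exp_nat_mul]; congr 1; ring
  simp only [h2]
  exact (summable_geometric_of_lt_one (Real.exp_nonneg _) h1).sum_le_tsum s
    fun _ _ => by positivity

/-- Gaps can be as long as `M`, and a factor `M` per gap could swallow a gain that is itself a power
of `M`. Weighting a gap `d` by `exp(-θd)` makes the sum over gaps geometric, at the single overall
cost `exp(θM)`. -/
lemma real_gapChainEvent_le {Q : Measure (ℕ → A)} [IsProbabilityMeasure Q] {G : ℕ → Set (ℕ → A)}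
    (hG : ∀ l, PrefixDetermined (G l)) {I : Finset ℕ} {d₀ : ℕ} {ρ t θ : ℝ} (hρ : 0 ≤ ρ)
    (ht : 0 ≤ t) (hθ : 0 < θ)
    (hdec : ∀ l ∈ I, ∀ d, d₀ ≤ d → ∀ E, PrefixDetermined E →
      Q.real (G l ∩ shift^[l + d] ⁻¹' E) ≤ ρ * Real.exp (t * l) * Q.real E) (j H M : ℕ) :
    Q.real (gapChainEvent G I d₀ j H M) ≤
      (I.card * ρ * (1 - Real.exp (-θ))⁻¹) ^ j * Real.exp (t * H + θ * M) := by
  have h1 : 0 < 1 - Real.exp (-θ) := by simpa using hθ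
  induction j generalizing H M with
  | zero =>
    rw [pow_zero, one_mul]
    exact measureReal_le_one.trans (Real.one_le_exp (by positivity))
  | succ j ih =>
    set R := (I.card * ρ * (1 - Real.exp (-θ))⁻¹) ^ j * Real.exp (t * H + θ * M) with hR
    have hR0 : 0 ≤ R := by positivity
    have hterm : ∀ l ∈ I.filter (· ≤ H), ∀ d ∈ (Finset.Icc d₀ M).filter (l + · ≤ M),
        Q.real (G l ∩ shift^[l + d] ⁻¹' gapChainEvent G I d₀ j (H - l) (M - (l + d))) ≤
          ρ * R * Real.exp (-(θ * d)) := by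
      intro l hl d hd
      simp only [Finset.mem_filter, Finset.mem_Icc] at hl hd
      refine (hdec l hl.1 d hd.1.1 _ (prefixDetermined_gapChainEvent hG I d₀ j _ _)).trans ?_
      refine (mul_le_mul_of_nonneg_left (ih _ _) (by positivity)).trans ?_
      have he : Real.exp (t * l) * Real.exp (t * (H - l : ℕ) + θ * (M - (l + d) : ℕ)) ≤
          Real.exp (t * H + θ * M) * Real.exp (-(θ * d)) := by
        rw [← Real.exp_add, ← Real.exp_add]
        refine Real.exp_le_exp.2 ?_
        rw [Nat.cast_sub hl.2, Nat.cast_sub hd.2]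
        push_cast
        have : 0 ≤ θ * l := by positivity
        linarith
      rw [hR]
      calc ρ * Real.exp (t * l) * ((I.card * ρ * (1 - Real.exp (-θ))⁻¹) ^ j *
            Real.exp (t * (H - l : ℕ) + θ * (M - (l + d) : ℕ)))
          = ρ * (I.card * ρ * (1 - Real.exp (-θ))⁻¹) ^ j * (Real.exp (t * l) *
            Real.exp (t * (H - l : ℕ) + θ * (M - (l + d) : ℕ))) := by ring
        _ ≤ ρ * (I.card * ρ * (1 - Real.exp (-θ))⁻¹) ^ j *
            (Real.exp (t * H + θ * M) * Real.exp (-(θ * d))) := by gcongr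
        _ = _ := by ring
    calc Q.real (gapChainEvent G I d₀ (j + 1) H M)
        ≤ ∑ l ∈ I.filter (· ≤ H), ∑ d ∈ (Finset.Icc d₀ M).filter (l + · ≤ M),
            ρ * R * Real.exp (-(θ * d)) := by
          refine (measureReal_biUnion_finset_le _ _).trans (Finset.sum_le_sum fun l hl => ?_)
          exact (measureReal_biUnion_finset_le _ _).trans
            (Finset.sum_le_sum fun d hd => hterm l hl d hd)
      _ ≤ ∑ l ∈ I.filter (· ≤ H), ρ * R * (1 - Real.exp (-θ))⁻¹ := by
          refine Finset.sum_le_sum fun l _ => ?_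
          rw [← Finset.mul_sum]
          exact mul_le_mul_of_nonneg_left (sum_exp_neg_le hθ _) (by positivity)
      _ ≤ I.card * (ρ * R * (1 - Real.exp (-θ))⁻¹) := by
          rw [Finset.sum_const, nsmul_eq_mul]
          gcongr
          exact Finset.filter_subset _ _
      _ = _ := by rw [hR]; ring

end Chains

/-! ### Borel–Cantelli and elementary estimates -/

section Estimates

lemma ae_eventually_notMem_of_summable {Ω : Type*} [MeasurableSpace Ω] {μ : Measure Ω}
    [IsFiniteMeasure μ] {s : ℕ → Set Ω} {u : ℕ → ℝ} (hu : Summable u)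
    (h : ∀ᶠ n in atTop, μ.real (s n) ≤ u n) : ∀ᵐ x ∂μ, ∀ᶠ n in atTop, x ∉ s n := by
  obtain ⟨n₀, hn₀⟩ := eventually_atTop.1 h
  have hs : ∑' n, μ (s (n + n₀)) ≠ ⊤ := by
    have h1 : ∀ n, μ (s (n + n₀)) ≤ ENNReal.ofReal (u (n + n₀)) := fun n => by
      rw [← ofReal_measureReal]
      exact ENNReal.ofReal_le_ofReal (hn₀ _ (by omega))
    exact ne_top_of_le_ne_top ((summable_nat_add_iff n₀).2 hu).tsum_ofReal_ne_top
      (ENNReal.tsum_le_tsum h1)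
  filter_upwards [ae_eventually_notMem hs] with x hx
  obtain ⟨n₁, hn₁⟩ := eventually_atTop.1 hx
  refine eventually_atTop.2 ⟨n₁ + n₀, fun n hn => ?_⟩
  have := hn₁ (n - n₀) (by omega)
  rwa [Nat.sub_add_cancel (by omega)] at this

lemma summable_exp_neg_mul {a : ℝ} (ha : 0 < a) : Summable fun n : ℕ => Real.exp (-(a * n)) := by
  have h1 : Real.exp (-a) < 1 := by simpa using ha
  refine (summable_geometric_of_lt_one (Real.exp_nonneg _) h1).congr fun n => ?_
  rw [← Real.exp_nat_mul]; congr 1; ring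

lemma eventually_linear_le_mul_exp {a c : ℝ} (ha : 0 < a) (hc : 0 < c) (B : ℝ) :
    ∀ᶠ m : ℕ in atTop, B * m + B ≤ c * Real.exp (a * m) := by
  obtain ⟨n₀, hn₀⟩ := exists_nat_gt (4 * |B| / (c * a ^ 2))
  filter_upwards [eventually_ge_atTop (n₀ + 1)] with m hm
  have hm1 : (1 : ℝ) ≤ m := by exact_mod_cast (by omega : 1 ≤ m)
  have hm2 : (n₀ : ℝ) ≤ m := by exact_mod_cast (by omega : n₀ ≤ m)
  rw [div_lt_iff₀ (by positivity)] at hn₀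
  have h1 := Real.quadratic_le_exp_of_nonneg (x := a * m) (by positivity)
  have h2 : (a * m) ^ 2 / 2 ≤ Real.exp (a * m) := by
    have : 0 ≤ a * m := by positivity
    linarith
  have h3 : 4 * |B| ≤ m * (c * a ^ 2) := hn₀.le.trans (by gcongr)
  have h4 : B ≤ |B| := le_abs_self B
  calc B * m + B ≤ |B| * m + |B| * m := by
        have : |B| ≤ |B| * m := le_mul_of_one_le_right (abs_nonneg B) hm1
        nlinarith
    _ = (4 * |B|) * m / 2 := by ring
    _ ≤ (m * (c * a ^ 2)) * m / 2 := by gcongr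
    _ = c * ((a * m) ^ 2 / 2) := by ring
    _ ≤ c * Real.exp (a * m) := by gcongr

lemma two_pow_eq_exp (m : ℕ) : (2 : ℝ) ^ m = Real.exp (Real.log 2 * m) := by
  rw [mul_comm, Real.exp_nat_mul, Real.exp_log (by norm_num)]

end Estimates

/-! ### Waiting times under selective lower decoupling -/

section Waiting

variable {A : Type*}

/-- The word `a` does not occur in the first `M` letters of the sequence. -/
def unseenEvent {l : ℕ} (a : Fin l → A) (M : ℕ) : Set (ℕ → A) :=
  {x | ∀ j, j + l ≤ M → firstWord (shift^[j] x) l ≠ a}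

lemma unseenEvent_anti {l : ℕ} (a : Fin l → A) {M M' : ℕ} (h : M ≤ M') :
    unseenEvent a M' ⊆ unseenEvent a M := fun _ hx j hj => hx j (hj.trans h)

lemma mem_unseenEvent_congr {l : ℕ} (a : Fin l → A) {M : ℕ} {x x' : ℕ → A}
    (h : firstWord x M = firstWord x' M) (hx : x ∈ unseenEvent a M) : x' ∈ unseenEvent a M := by
  intro j hj
  have : firstWord (shift^[j] x') l = firstWord (shift^[j] x) l := by
    ext i
    simp only [firstWord, shift_iterate_apply]
    exact (congrFun h ⟨j + i, by omega⟩).symm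
  rw [this]
  exact hx j hj

lemma notMem_unseenEvent_iff {M l : ℕ} {y x : ℕ → A} :
    x ∉ unseenEvent (firstWord y l) M ↔ SeenIn M l y x := by
  simp only [unseenEvent, Set.mem_ofPred_eq, not_forall, not_not, SeenIn,
    firstWord_shift_eq_iff, firstWord, exists_prop]
  exact exists_congr fun j => and_congr_right fun _ =>
    ⟨fun h i hi => h ⟨i, hi⟩, fun h i => h i i.2⟩

variable [Fintype A] [MeasurableSpace A] [DiscreteMeasurableSpace A]

/-- One trial: the last `M` letters must themselves avoid `a`, and whatever word `b` they form,
lower decoupling puts `a` in the `l + τ` letters before it with conditional probability at least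
`δ`. -/
lemma real_unseenEvent_add_le {P : Measure (ℕ → A)} [IsProbabilityMeasure P]
    (hinv : MeasurePreserving shift P P) {l τ M : ℕ} {a : Fin l → A} {δ : ℝ}
    (h : ∀ b ∈ wordSupport P M, ∃ q ≤ τ, ∃ ξ : Fin q → A,
      δ * wordProb P b ≤ wordProb P (Fin.append (Fin.append a ξ) b)) :
    P.real (unseenEvent a (M + (l + τ))) ≤ (1 - δ) * P.real (unseenEvent a M) := by
  classical
  set B : Set (Fin M → A) := (fun x => firstWord x M) '' unseenEvent a M with hB
  have hU : unseenEvent a M = {x | firstWord x M ∈ B} := by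
    ext x
    refine ⟨fun hx => ⟨x, hx, rfl⟩, ?_⟩
    rintro ⟨x', hx', hxx⟩
    exact mem_unseenEvent_congr a hxx hx'
  have hterm : ∀ b : Fin M → A,
      P.real (shift^[l + τ] ⁻¹' wordCylinder b ∩ unseenEvent a (M + (l + τ))) ≤
        (1 - δ) * wordProb P b := by
    intro b
    have hb' : P.real (shift^[l + τ] ⁻¹' wordCylinder b) = wordProb P b :=
      real_preimage_shift hinv _ (measurableSet_wordCylinder b)
    by_cases hb : b ∈ wordSupport P M
    · obtain ⟨q, hq, ξ, hξ⟩ := h b hb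
      set c := Fin.append (Fin.append a ξ) b with hc
      have hmem : ∀ x, x ∈ shift^[τ - q] ⁻¹' wordCylinder c →
          firstWord (shift^[τ - q] x) l = a ∧ x ∈ shift^[l + τ] ⁻¹' wordCylinder b := by
        intro x hx
        have h1 := firstWord_append_iff.1 hx
        refine ⟨(firstWord_append_iff.1 h1.1).1, ?_⟩
        have h2 := h1.2
        rw [shift_iterate_shift_iterate, show τ - q + (l + q) = l + τ by omega] at h2
        exact h2
      -- The gap length `q` depends on `b`; starting `aξb` at offset `τ - q` aligns `b` with
      -- position `l + τ` in every case.
      have hdisj : Disjoint (shift^[l + τ] ⁻¹' wordCylinder b ∩ unseenEvent a (M + (l + τ)))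
          (shift^[τ - q] ⁻¹' wordCylinder c) := by
        rw [Set.disjoint_left]
        rintro x ⟨-, hx⟩ hx'
        exact hx (τ - q) (by omega) (hmem x hx').1
      have hsum := measureReal_union (μ := P) hdisj
        (measurable_shift_iterate _ (measurableSet_wordCylinder c))
      have hle : P.real ((shift^[l + τ] ⁻¹' wordCylinder b ∩ unseenEvent a (M + (l + τ))) ∪
          (shift^[τ - q] ⁻¹' wordCylinder c)) ≤ wordProb P b := by
        rw [← hb']
        exact measureReal_mono (Set.union_subset Set.inter_subset_left fun x hx => (hmem x hx).2)
      rw [real_preimage_shift hinv _ (measurableSet_wordCylinder c)] at hsum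
      have : wordProb P c = P.real (wordCylinder c) := rfl
      linarith
    · have h0 : wordProb P b = 0 := le_antisymm (not_lt.1 hb) (wordProb_nonneg P b)
      rw [h0, mul_zero, ← h0, ← hb']
      exact measureReal_mono Set.inter_subset_left
  have hsub : unseenEvent a (M + (l + τ)) ⊆ ⋃ b ∈ Finset.univ.filter (· ∈ B),
      shift^[l + τ] ⁻¹' wordCylinder b ∩ unseenEvent a (M + (l + τ)) := by
    intro x hx
    simp only [Set.mem_iUnion]
    refine ⟨firstWord (shift^[l + τ] x) M, ?_, rfl, hx⟩
    simp only [Finset.mem_filter, Finset.mem_univ, true_and]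
    refine ⟨_, fun j hj => ?_, rfl⟩
    rw [shift_iterate_shift_iterate]
    exact hx _ (by omega)
  refine (measureReal_mono hsub (measure_ne_top _ _)).trans
    ((measureReal_biUnion_finset_le _ _).trans ((Finset.sum_le_sum fun b _ => hterm b).trans_eq ?_))
  rw [hU, real_firstWord_mem, Finset.mul_sum]

/-- Under selective lower decoupling, the waiting time of a word has an exponential tail. -/
lemma SelectivelyLowerDecoupled.exists_real_unseenEvent_le {P : Measure (ℕ → A)}
    [IsProbabilityMeasure P] (hinv : MeasurePreserving shift P P)
    (hP : SelectivelyLowerDecoupled P) {ε : ℝ} (hε : 0 < ε) :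
    ∃ C : ℝ, 0 ≤ C ∧ ∀ l : ℕ, 1 ≤ l → ∀ a ∈ wordSupport P l, ∀ N j : ℕ,
      1 + j * (l + (ε * l + C)) ≤ (N : ℝ) →
      P.real (unseenEvent a N) ≤ Real.exp (-(j * (Real.exp (-(ε * l + C)) * wordProb P a))) := by
  obtain ⟨k, τ, hk0, hk, hτ, h⟩ := hP
  obtain ⟨C₁, hC₁, h₁⟩ := exists_linear_bound hk hε
  obtain ⟨C₂, hC₂, h₂⟩ := exists_linear_bound hτ hε
  refine ⟨C₁ + C₂, by positivity, fun l hl a ha N j hN => ?_⟩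
  set δ := Real.exp (-k l) * wordProb P a with hδ
  have hδ1 : δ ≤ 1 := mul_le_one₀ (Real.exp_le_one_iff.2 (by linarith [hk0 l]))
    (wordProb_nonneg P a) (wordProb_le_one P a)
  -- The initial letter is there because decoupling requires a nonempty `b`.
  have hiter : ∀ i : ℕ, P.real (unseenEvent a (1 + i * (l + τ l))) ≤ (1 - δ) ^ i := by
    intro i
    induction i with
    | zero => simp
    | succ i ih =>
      have hstep := real_unseenEvent_add_le hinv (P := P) (l := l) (τ := τ l)
        (M := 1 + i * (l + τ l)) (a := a) (δ := δ) fun b hb => by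
          obtain ⟨q, hq, ξ, -, hξ⟩ := h l hl a ha _ (by omega) b hb
          exact ⟨q, hq, ξ, by rw [hδ, mul_assoc]; exact hξ⟩
      rw [show 1 + (i + 1) * (l + τ l) = 1 + i * (l + τ l) + (l + τ l) by ring, pow_succ']
      exact hstep.trans (mul_le_mul_of_nonneg_left ih (by linarith))
  have hN' : 1 + j * (l + τ l) ≤ N := by
    have h3 : (τ l : ℝ) ≤ ε * l + (C₁ + C₂) := by linarith [h₂ l]
    have h4 : (1 : ℝ) + j * (l + τ l) ≤ N := le_trans (by gcongr) hN
    exact_mod_cast h4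
  refine (measureReal_mono (unseenEvent_anti a hN')).trans ((hiter j).trans ?_)
  calc (1 - δ) ^ j ≤ Real.exp (-δ) ^ j := by
        gcongr
        linarith [Real.add_one_le_exp (-δ)]
    _ = Real.exp (-(j * δ)) := by rw [← Real.exp_nat_mul]; congr 1; ring
    _ ≤ _ := by
        refine Real.exp_le_exp.2 (neg_le_neg ?_)
        rw [hδ]
        have := wordProb_nonneg P a
        gcongr
        linarith [h₁ l]

/-- Almost surely, all words of logarithmic length that are not too improbable occur early. -/
lemma SelectivelyLowerDecoupled.ae_eventually_seen {P : Measure (ℕ → A)}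
    [IsProbabilityMeasure P] (hinv : MeasurePreserving shift P P)
    (hP : SelectivelyLowerDecoupled P) (K : ℕ) {δ : ℝ} (hδ : 0 < δ) (hδ1 : δ < 1) :
    ∀ᵐ x ∂P, ∀ᶠ m : ℕ in atTop, ∀ l, 1 ≤ l → l ≤ K * m → ∀ a : Fin l → A,
      Real.exp (-((1 - δ) * Real.log 2 * m)) ≤ wordProb P a → x ∉ unseenEvent a (2 ^ m) := by
  classical
  set r := Real.log 2 with hr
  have hr0 : 0 < r := Real.log_pos (by norm_num)
  set ε := δ * r / (4 * (K + 1)) with hε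
  have hε0 : 0 < ε := by positivity
  obtain ⟨C, hC0, hC⟩ := hP.exists_real_unseenEvent_le hinv hε0
  set R := Real.log (Fintype.card A) with hR
  have hR0 : 0 ≤ R := Real.log_natCast_nonneg _
  have hcard : (Fintype.card A : ℝ) ≤ Real.exp R := Real.le_exp_log _
  have hεK : ∀ l m : ℕ, l ≤ K * m → ε * l ≤ δ * r / 4 * m := by
    intro l m hl
    have h1 : (l : ℝ) ≤ (K + 1) * m := by
      have : (l : ℝ) ≤ K * m := by exact_mod_cast hl
      linarith [Nat.cast_nonneg (α := ℝ) m]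
    calc ε * l ≤ ε * ((K + 1) * m) := by gcongr
      _ = δ * r / 4 * m := by rw [hε]; field_simp
  set bad : ℕ → Set (ℕ → A) := fun m => ⋃ l ∈ Finset.Icc 1 (K * m),
    ⋃ a ∈ Finset.univ.filter
      (fun a : Fin l → A => Real.exp (-((1 - δ) * r * m)) ≤ wordProb P a),
    unseenEvent a (2 ^ m) with hbad
  have hest : ∀ᶠ m : ℕ in atTop, P.real (bad m) ≤ Real.exp (-(1 * (m : ℝ))) := by
    have e1 := eventually_linear_le_mul_exp (a := δ * r / 4) (c := 1) (by positivity) one_pos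
      (2 * (K + δ * r / 4 + C) + 2)
    have e2 := eventually_linear_le_mul_exp (a := δ * r / 4) (c := Real.exp (-C)) (by positivity)
      (Real.exp_pos _) (K + K * R + 1)
    filter_upwards [e1, e2, eventually_ge_atTop 1] with m h1 h2 hm
    have hm1 : (1 : ℝ) ≤ m := by exact_mod_cast hm
    set D : ℝ := K * m + (δ * r / 4 * m + C) with hD
    have hD0 : 0 ≤ D := by positivity
    -- the number of independent trials
    set j : ℕ := ⌊(Real.exp (r * m) - 1) / (D + 1)⌋₊ with hj
    have hexp1 : 1 ≤ Real.exp (r * m) := Real.one_le_exp (by positivity)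
    have hjle : (j : ℝ) * (D + 1) ≤ Real.exp (r * m) - 1 := by
      have := Nat.floor_le (a := (Real.exp (r * m) - 1) / (D + 1))
        (div_nonneg (by linarith) (by linarith))
      rwa [le_div_iff₀ (by linarith)] at this
    -- A trial takes `O(m)` letters, so about `2^m / m` trials fit, which exceeds `2^((1 - δ/4)m)`.
    have hjge : Real.exp ((1 - δ / 4) * r * m) ≤ j := by
      have h3 := Nat.lt_floor_add_one ((Real.exp (r * m) - 1) / (D + 1))
      rw [div_lt_iff₀ (by linarith), ← hj] at h3
      have h4 : Real.exp ((1 - δ / 4) * r * m) * Real.exp (δ * r / 4 * m) = Real.exp (r * m) := by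
        rw [← Real.exp_add]; congr 1; ring
      have h5 : 1 ≤ Real.exp ((1 - δ / 4) * r * m) :=
        Real.one_le_exp (mul_nonneg (mul_nonneg (by linarith) hr0.le) (by linarith))
      have h6 : 2 * (D + 1) + 1 ≤ Real.exp (δ * r / 4 * m) := by
        refine le_trans ?_ (h1.trans_eq (one_mul _))
        have : C ≤ C * m := le_mul_of_one_le_right hC0 hm1
        have : 0 ≤ (K : ℝ) := by positivity
        have : 0 ≤ δ * r / 4 := by positivity
        rw [hD]
        linarith
      have h7 : (2 * (D + 1) + 1) * Real.exp ((1 - δ / 4) * r * m) ≤ Real.exp (r * m) := by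
        rw [← h4, mul_comm]
        gcongr
      by_contra hlt
      rw [not_le] at hlt
      have h8 : ((j : ℝ) + 1) * (D + 1) ≤ 2 * (D + 1) * Real.exp ((1 - δ / 4) * r * m) := by
        have : (j : ℝ) + 1 ≤ 2 * Real.exp ((1 - δ / 4) * r * m) := by linarith
        calc ((j : ℝ) + 1) * (D + 1) ≤ (2 * Real.exp ((1 - δ / 4) * r * m)) * (D + 1) := by
              gcongr
          _ = _ := by ring
      linarith
    -- The expected number of successes is at least of order `2^(δm/2)`, so the failure probability
    -- is doubly exponentially small and beats the at most exponentially many candidate words.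
    set w := Real.exp (-(Real.exp (-C) * Real.exp (δ * r / 2 * m))) with hw
    have hterm : ∀ l ∈ Finset.Icc 1 (K * m), ∀ a ∈ Finset.univ.filter
        (fun a : Fin l → A => Real.exp (-((1 - δ) * r * m)) ≤ wordProb P a),
        P.real (unseenEvent a (2 ^ m)) ≤ w := by
      intro l hl a ha
      rw [Finset.mem_Icc] at hl
      have ha' := (Finset.mem_filter.1 ha).2
      have hεl := hεK l m hl.2
      have hlK : (l : ℝ) ≤ K * m := by exact_mod_cast hl.2
      refine (hC l hl.1 a (lt_of_lt_of_le (Real.exp_pos _) ha') (2 ^ m) j ?_).trans ?_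
      · push_cast
        rw [two_pow_eq_exp]
        have : (j : ℝ) * (l + (ε * l + C)) ≤ j * (D + 1) :=
          mul_le_mul_of_nonneg_left (by rw [hD]; linarith) (Nat.cast_nonneg j)
        linarith
      · rw [hw]
        refine Real.exp_le_exp.2 (neg_le_neg ?_)
        calc Real.exp (-C) * Real.exp (δ * r / 2 * m)
            = Real.exp ((1 - δ / 4) * r * m) *
              (Real.exp (-(δ * r / 4 * m + C)) * Real.exp (-((1 - δ) * r * m))) := by
              rw [← Real.exp_add, ← Real.exp_add, ← Real.exp_add]; congr 1; ring
          _ ≤ _ := by gcongr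
    have hcardsum : ∀ l ∈ Finset.Icc 1 (K * m), ∑ a ∈ Finset.univ.filter
        (fun a : Fin l → A => Real.exp (-((1 - δ) * r * m)) ≤ wordProb P a),
        P.real (unseenEvent a (2 ^ m)) ≤ Real.exp (R * (K * m)) * w := by
      intro l hl
      refine (Finset.sum_le_sum (hterm l hl)).trans ?_
      rw [Finset.sum_const, nsmul_eq_mul]
      refine mul_le_mul_of_nonneg_right ?_ (Real.exp_nonneg _)
      have hc : ((Finset.univ.filter
          (fun a : Fin l → A => Real.exp (-((1 - δ) * r * m)) ≤ wordProb P a)).card : ℝ) ≤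
          (Fintype.card A : ℝ) ^ l := by
        have := Finset.card_filter_le (Finset.univ : Finset (Fin l → A))
          (fun a => Real.exp (-((1 - δ) * r * m)) ≤ wordProb P a)
        rw [Finset.card_univ, Fintype.card_pi_const] at this
        exact_mod_cast this
      refine hc.trans ((pow_le_pow_left₀ (by positivity) hcard l).trans ?_)
      rw [← Real.exp_nat_mul, mul_comm]
      refine Real.exp_le_exp.2 ?_
      have : (l : ℝ) ≤ K * m := by exact_mod_cast (Finset.mem_Icc.1 hl).2
      gcongr
    have htotal : P.real (bad m) ≤ (K * m) * (Real.exp (R * (K * m)) * w) := by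
      refine (measureReal_biUnion_finset_le _ _).trans ?_
      refine (Finset.sum_le_sum fun l hl =>
        (measureReal_biUnion_finset_le _ _).trans (hcardsum l hl)).trans_eq ?_
      rw [Finset.sum_const, Nat.card_Icc, nsmul_eq_mul]
      push_cast [Nat.add_sub_cancel]
      ring
    refine htotal.trans ?_
    have h3 : (K * m : ℝ) ≤ Real.exp (K * m) := by linarith [Real.add_one_le_exp (K * m : ℝ)]
    calc (K * m : ℝ) * (Real.exp (R * (K * m)) * w)
        ≤ Real.exp (K * m) * (Real.exp (R * (K * m)) * w) := by gcongr
      _ = Real.exp (K * m + R * (K * m) - Real.exp (-C) * Real.exp (δ * r / 2 * m)) := by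
          rw [hw, ← Real.exp_add, ← Real.exp_add]; congr 1; ring
      _ ≤ Real.exp (-(1 * (m : ℝ))) := by
          refine Real.exp_le_exp.2 ?_
          have h4 : Real.exp (δ * r / 4 * m) ≤ Real.exp (δ * r / 2 * m) := by
            refine Real.exp_le_exp.2 ?_
            have : 0 ≤ δ * r * m := by positivity
            linarith
          have h5 : Real.exp (-C) * Real.exp (δ * r / 4 * m) ≤
            Real.exp (-C) * Real.exp (δ * r / 2 * m) := by gcongr
          have h6 : 0 ≤ (K : ℝ) + K * R + 1 := by positivity
          nlinarith
  filter_upwards [ae_eventually_notMem_of_summable (summable_exp_neg_mul one_pos) hest] with x hx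
  filter_upwards [hx] with m hm l hl1 hl2 a ha hxa
  refine hm ?_
  simp only [hbad, Set.mem_iUnion]
  exact ⟨l, Finset.mem_Icc.2 ⟨hl1, hl2⟩, a, Finset.mem_filter.2 ⟨Finset.mem_univ _, ha⟩, hxa⟩

end Waiting

/-! ### Matches between independent sequences -/

section Matches

variable {A : Type*}

/-- The word of length `n` at position `i` of `y` is the word at position `j` of `x`. -/
def matchEvent (A : Type*) (n i j : ℕ) : Set ((ℕ → A) × (ℕ → A)) :=
  {xy | firstWord (shift^[j] xy.1) n = firstWord (shift^[i] xy.2) n}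

lemma seenIn_iff_exists_matchEvent {N n i : ℕ} {y x : ℕ → A} :
    SeenIn N n (shift^[i] y) x ↔ ∃ j, j + n ≤ N ∧ (x, y) ∈ matchEvent A n i j := by
  simp only [SeenIn, matchEvent, Set.mem_ofPred_eq, firstWord_shift_eq_iff, firstWord]
  exact exists_congr fun j => and_congr_right fun _ =>
    ⟨fun h i => h i i.2, fun h i hi => h ⟨i, hi⟩⟩

variable [Fintype A] [MeasurableSpace A] [DiscreteMeasurableSpace A]

lemma measurableSet_matchEvent (n i j : ℕ) : MeasurableSet (matchEvent A n i j) := by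
  have : matchEvent A n i j = ⋃ a : Fin n → A,
      (shift^[j] ⁻¹' wordCylinder a) ×ˢ (shift^[i] ⁻¹' wordCylinder a) := by
    ext xy
    simp only [matchEvent, Set.mem_ofPred_eq, Set.mem_iUnion, Set.mem_prod, Set.mem_preimage,
      wordCylinder]
    exact ⟨fun h => ⟨_, h, rfl⟩, fun ⟨a, h1, h2⟩ => h1.trans h2.symm⟩
  rw [this]
  exact MeasurableSet.iUnion fun a =>
    (measurable_shift_iterate j (measurableSet_wordCylinder a)).prod
      (measurable_shift_iterate i (measurableSet_wordCylinder a))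

lemma measurableSet_seenIn (N n : ℕ) :
    MeasurableSet {xy : (ℕ → A) × (ℕ → A) | SeenIn N n xy.2 xy.1} := by
  have : {xy : (ℕ → A) × (ℕ → A) | SeenIn N n xy.2 xy.1} =
      ⋃ j ∈ {j | j + n ≤ N}, matchEvent A n 0 j := by
    ext xy
    have := seenIn_iff_exists_matchEvent (N := N) (n := n) (i := 0) (y := xy.2) (x := xy.1)
    simpa using this
  rw [this]
  exact MeasurableSet.biUnion (Set.to_countable _) fun j _ => measurableSet_matchEvent n 0 j

variable {P Q : Measure (ℕ → A)} [IsProbabilityMeasure P] [IsProbabilityMeasure Q]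

lemma real_matchEvent_le (hP : MeasurePreserving shift P P) (hQ : MeasurePreserving shift Q Q)
    (n i j : ℕ) : (P.prod Q).real (matchEvent A n i j) ≤ crossSum P Q n (-1) := by
  classical
  have hsub : matchEvent A n i j ⊆ ⋃ a ∈ (Finset.univ : Finset (Fin n → A)),
      (shift^[j] ⁻¹' wordCylinder a) ×ˢ (shift^[i] ⁻¹' wordCylinder a) := by
    intro xy hxy
    simp only [Set.mem_iUnion]
    exact ⟨_, Finset.mem_univ _, hxy, rfl⟩
  refine (measureReal_mono hsub (measure_ne_top _ _)).trans
    ((measureReal_biUnion_finset_le _ _).trans_eq ?_)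
  unfold crossSum
  rw [Finset.sum_filter]
  refine Finset.sum_congr rfl fun a _ => ?_
  rw [measureReal_prod_prod, real_preimage_shift hP _ (measurableSet_wordCylinder a),
    real_preimage_shift hQ _ (measurableSet_wordCylinder a)]
  split_ifs with ha
  · rw [neg_neg, Real.rpow_one]; rfl
  · have h0 : P.real (wordCylinder a) = 0 := le_antisymm (not_lt.1 ha) measureReal_nonneg
    rw [h0, zero_mul]

/-- Under nondegeneracy, matches between the two sequences have at most logarithmic length. -/
lemma Nondegenerate.exists_ae_eventually_seenIn_le (hP : MeasurePreserving shift P P)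
    (hQ : MeasurePreserving shift Q Q) (hnd : Nondegenerate P Q) :
    ∃ K : ℕ, 1 ≤ K ∧ ∀ᵐ xy ∂(P.prod Q), ∀ᶠ m : ℕ in atTop, ∀ p < 2 ^ (m + 1), ∀ l,
      SeenIn (2 ^ (m + 1)) l (shift^[p] xy.2) xy.1 → l ≤ K * m := by
  obtain ⟨t, ht1, ht2⟩ := EReal.lt_iff_exists_real_btwn.1 hnd
  have ht : t < 0 := by exact_mod_cast ht2
  obtain ⟨C, -, hC⟩ := exists_crossSum_le ht1
  set r := Real.log 2 with hr
  have hr0 : 0 < r := Real.log_pos (by norm_num)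
  -- There are `4 · 4^m` pairs of positions; this `K` makes a match of length `K * m` cost `8^(-m)`
  -- up to a constant, leaving a summable `2^(-m)`.
  obtain ⟨K, hK⟩ := exists_nat_gt (3 * r / (-t))
  rw [div_lt_iff₀ (by linarith)] at hK
  have hK1 : 1 ≤ K := by
    rcases Nat.eq_zero_or_pos K with h | h
    · rw [h] at hK
      norm_num at hK
      linarith
    · exact h
  refine ⟨K, hK1, ?_⟩
  set bad : ℕ → Set ((ℕ → A) × (ℕ → A)) := fun m => ⋃ i ∈ Finset.range (2 ^ (m + 1)),
    ⋃ j ∈ Finset.range (2 ^ (m + 1)), matchEvent A (K * m) i j with hbad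
  have hest : ∀ m, (P.prod Q).real (bad m) ≤ 4 * Real.exp C * Real.exp (-(r * m)) := by
    intro m
    have h1 : (P.prod Q).real (bad m) ≤
        ∑ i ∈ Finset.range (2 ^ (m + 1)), ∑ j ∈ Finset.range (2 ^ (m + 1)),
          Real.exp (t * (K * m : ℕ) + C) := by
      refine (measureReal_biUnion_finset_le _ _).trans (Finset.sum_le_sum fun i _ => ?_)
      refine (measureReal_biUnion_finset_le _ _).trans (Finset.sum_le_sum fun j _ => ?_)
      exact (real_matchEvent_le hP hQ _ i j).trans (hC _)
    refine h1.trans ?_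
    simp only [Finset.sum_const, Finset.card_range, nsmul_eq_mul]
    push_cast
    rw [pow_succ, two_pow_eq_exp, ← hr]
    calc Real.exp (r * m) * 2 * (Real.exp (r * m) * 2 * Real.exp (t * (K * m) + C))
        = 4 * (Real.exp (r * m) * Real.exp (r * m) * Real.exp (t * (K * m) + C)) := by ring
      _ = 4 * Real.exp (r * m + r * m + (t * (K * m) + C)) := by
          rw [← Real.exp_add, ← Real.exp_add]
      _ ≤ 4 * Real.exp (C + -(r * m)) := by
          refine mul_le_mul_of_nonneg_left (Real.exp_le_exp.2 ?_) (by norm_num)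
          have := mul_le_mul_of_nonneg_right hK.le (Nat.cast_nonneg (α := ℝ) m)
          linarith
      _ = _ := by rw [Real.exp_add]; ring
  filter_upwards [ae_eventually_notMem_of_summable
    ((summable_exp_neg_mul hr0).mul_left (4 * Real.exp C)) (Eventually.of_forall hest)] with xy hxy
  filter_upwards [hxy, eventually_ge_atTop 1] with m hm hm1 p hp l hl
  by_contra hlt
  obtain ⟨j, hj, hj'⟩ := seenIn_iff_exists_matchEvent.1 (hl.mono (le_refl _) (not_le.1 hlt).le)
  refine hm ?_
  have : 1 ≤ K * m := Nat.mul_pos hK1 hm1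
  simp only [hbad, Set.mem_iUnion, Finset.mem_range]
  exact ⟨p, hp, j, by omega, hj'⟩

/-- A word `a` is seen with probability at most `min(1, (N+1)P[a])`, hence at most `((N+1)P[a])^β`
since `β ≤ 1`. -/
lemma real_setOf_seenIn_le (hP : MeasurePreserving shift P P)
    (hsupp : seqSupport Q ⊆ seqSupport P) (N n : ℕ) {β : ℝ} (hβ : 0 < β) (hβ1 : β ≤ 1) :
    (P.prod Q).real {xy | SeenIn N n xy.2 xy.1} ≤ (N + 1 : ℝ) ^ β * crossSum P Q n (-β) := by
  classical
  have hsub : {xy : (ℕ → A) × (ℕ → A) | SeenIn N n xy.2 xy.1} ⊆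
      ⋃ a ∈ (Finset.univ : Finset (Fin n → A)),
        (⋃ j ∈ Finset.range (N + 1), shift^[j] ⁻¹' wordCylinder a) ×ˢ wordCylinder a := by
    intro xy hxy
    obtain ⟨j, hj, hj'⟩ := (seenIn_iff_exists_matchEvent (i := 0)).1 hxy
    simp only [Set.mem_iUnion, Set.mem_prod]
    exact ⟨firstWord xy.2 n, Finset.mem_univ _, ⟨j, Finset.mem_range.2 (by omega), hj'⟩, rfl⟩
  refine (measureReal_mono hsub (measure_ne_top _ _)).trans
    ((measureReal_biUnion_finset_le _ _).trans ?_)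
  unfold crossSum
  rw [Finset.mul_sum, Finset.sum_filter]
  refine Finset.sum_le_sum fun a _ => ?_
  rw [measureReal_prod_prod]
  have hq : Q.real (wordCylinder a) = wordProb Q a := rfl
  rw [hq, neg_neg]
  split_ifs with ha
  · rw [← mul_assoc]
    refine mul_le_mul_of_nonneg_right ?_ (wordProb_nonneg Q a)
    rw [← Real.mul_rpow (by positivity) (wordProb_nonneg P a)]
    have h1 : P.real (⋃ j ∈ Finset.range (N + 1), shift^[j] ⁻¹' wordCylinder a) ≤
        (N + 1 : ℝ) * wordProb P a := by
      refine (measureReal_biUnion_finset_le _ _).trans_eq ?_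
      rw [Finset.sum_congr rfl fun j _ => real_preimage_shift hP j (measurableSet_wordCylinder a)]
      simp [wordProb]
    have h2 := (measureReal_nonneg (μ := P)
      (s := ⋃ j ∈ Finset.range (N + 1), shift^[j] ⁻¹' wordCylinder a))
    calc P.real (⋃ j ∈ Finset.range (N + 1), shift^[j] ⁻¹' wordCylinder a)
        ≤ P.real (⋃ j ∈ Finset.range (N + 1), shift^[j] ⁻¹' wordCylinder a) ^ β :=
          Real.self_le_rpow_of_le_one h2 measureReal_le_one hβ1
      _ ≤ _ := Real.rpow_le_rpow h2 h1 hβ.le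
  · have h0 : wordProb Q a = 0 := by
      by_contra h0
      exact ha (wordProb_pos_of_seqSupport_subset hsupp
        (lt_of_le_of_ne (wordProb_nonneg Q a) (Ne.symm h0)))
    rw [h0, mul_zero]

/-- Markov's inequality for the measure of the sections, whose mean is the product measure. -/
lemma real_setOf_lt_section_le {Ω Ω' : Type*} [MeasurableSpace Ω] [MeasurableSpace Ω']
    {μ : Measure Ω} {ν : Measure Ω'} [IsFiniteMeasure μ] [IsFiniteMeasure ν] {S : Set (Ω × Ω')}
    (hS : MeasurableSet S) {c : ℝ} (hc : 0 < c) :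
    μ.real {x | c < ν.real (Prod.mk x ⁻¹' S)} ≤ (μ.prod ν).real S / c := by
  have h1 := mul_meas_ge_le_lintegral (μ := μ) (measurable_measure_prodMk_left (ν := ν) hS)
    (ENNReal.ofReal c)
  rw [← Measure.prod_apply hS] at h1
  have h2 : μ {x | c < ν.real (Prod.mk x ⁻¹' S)} ≤
      μ {x | ENNReal.ofReal c ≤ ν (Prod.mk x ⁻¹' S)} := by
    refine measure_mono fun x hx => ?_
    exact (ENNReal.ofReal_le_iff_le_toReal (measure_ne_top _ _)).2 (le_of_lt hx)
  rw [le_div_iff₀ hc, mul_comm]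
  have h3 := (mul_le_mul_right h2 (ENNReal.ofReal c)).trans h1
  have h4 := ENNReal.toReal_mono (measure_ne_top _ _) h3
  rwa [ENNReal.toReal_mul, ENNReal.toReal_ofReal hc.le] at h4

/-- For almost every `x`, the set of words seen early in `x` has small `Q`-measure. -/
lemma exists_ae_eventually_real_seenIn_le (hP : MeasurePreserving shift P P)
    (hsupp : seqSupport Q ⊆ seqSupport P) {β t η : ℝ} (hβ : 0 < β) (hβ1 : β ≤ 1)
    (ht : pressure P Q (-β) < t) (hη : 0 < η) (K : ℕ) :
    ∃ C : ℝ, 0 ≤ C ∧ ∀ᵐ x ∂P, ∀ᶠ m : ℕ in atTop, ∀ n ≤ K * m,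
      Q.real {y | SeenIn (2 ^ (m + 1)) n y x} ≤
        Real.exp ((β * Real.log 2 + η) * m + t * n + C) := by
  obtain ⟨C, hC0, hC⟩ := exists_crossSum_le ht
  set r := Real.log 2 with hr
  set C' := C + β * Real.log 4 with hC'
  have hlog4 : 0 < Real.log 4 := Real.log_pos (by norm_num)
  refine ⟨C', by positivity, ?_⟩
  set bad : ℕ → Set (ℕ → A) := fun m => ⋃ n ∈ Finset.range (K * m + 1),
    {x | Real.exp ((β * r + η) * m + t * n + C') < Q.real {y | SeenIn (2 ^ (m + 1)) n y x}}
    with hbad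
  -- The slack `η` gives `exp(-ηm)` for each length; half of it absorbs the `K * m + 1` lengths.
  have hest : ∀ᶠ m : ℕ in atTop, P.real (bad m) ≤ Real.exp (-(η / 2 * m)) := by
    filter_upwards [eventually_linear_le_mul_exp (half_pos hη) one_pos (K + 1)] with m hm
    have hterm : ∀ n ∈ Finset.range (K * m + 1),
        P.real {x | Real.exp ((β * r + η) * m + t * n + C') <
          Q.real {y | SeenIn (2 ^ (m + 1)) n y x}} ≤ Real.exp (-(η * m)) := by
      intro n _
      refine (real_setOf_lt_section_le (measurableSet_seenIn (2 ^ (m + 1)) n)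
        (Real.exp_pos _)).trans ?_
      rw [div_le_iff₀ (Real.exp_pos _), ← Real.exp_add]
      refine (real_setOf_seenIn_le hP hsupp _ n hβ hβ1).trans ?_
      have h1 : (((2 ^ (m + 1) : ℕ) : ℝ) + 1) ^ β ≤ Real.exp (β * (r * m) + β * Real.log 4) := by
        have h2 : ((2 ^ (m + 1) : ℕ) : ℝ) + 1 ≤ Real.exp (r * m + Real.log 4) := by
          rw [Real.exp_add, Real.exp_log (by norm_num)]
          push_cast
          rw [pow_succ, two_pow_eq_exp, ← hr]
          have : 1 ≤ Real.exp (r * m) := Real.one_le_exp (by positivity)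
          linarith
        refine (Real.rpow_le_rpow (by positivity) h2 hβ.le).trans_eq ?_
        rw [← Real.exp_mul]; congr 1; ring
      refine (mul_le_mul h1 (hC n) (crossSum_nonneg P Q n _) (Real.exp_nonneg _)).trans_eq ?_
      rw [← Real.exp_add, hC']
      congr 1; ring
    refine (measureReal_biUnion_finset_le _ _).trans ((Finset.sum_le_sum hterm).trans ?_)
    rw [Finset.sum_const, Finset.card_range, nsmul_eq_mul]
    have h1 : ((K * m + 1 : ℕ) : ℝ) ≤ Real.exp (η / 2 * m) := by
      push_cast
      have : (0 : ℝ) ≤ K := Nat.cast_nonneg K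
      have : (0 : ℝ) ≤ m := Nat.cast_nonneg m
      linarith
    calc ((K * m + 1 : ℕ) : ℝ) * Real.exp (-(η * m))
        ≤ Real.exp (η / 2 * m) * Real.exp (-(η * m)) := by gcongr
      _ = _ := by rw [← Real.exp_add]; congr 1; ring
  filter_upwards [ae_eventually_notMem_of_summable (summable_exp_neg_mul (half_pos hη)) hest]
    with x hx
  filter_upwards [hx] with m hm n hn
  by_contra hlt
  refine hm ?_
  simp only [hbad, Set.mem_iUnion, Finset.mem_range]
  exact ⟨n, by omega, not_le.1 hlt⟩

end Matches

/-! ### The lower bound -/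

section DyadicScale

lemma tendsto_log_two_atTop : Tendsto (fun N : ℕ => Nat.log 2 N) atTop atTop :=
  tendsto_atTop.2 fun b => by
    filter_upwards [eventually_ge_atTop (2 ^ b)] with N hN
    exact Nat.le_log_of_pow_le (by norm_num) hN

lemma exp_log_two_mul_le {N : ℕ} (hN : 1 ≤ N) : Real.exp (Real.log 2 * Nat.log 2 N) ≤ N := by
  rw [← two_pow_eq_exp]
  exact_mod_cast Nat.pow_log_le_self 2 (by omega)

lemma log_two_mul_le_log {N : ℕ} (hN : 1 ≤ N) : Real.log 2 * Nat.log 2 N ≤ Real.log N := by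
  rw [Real.le_log_iff_exp_le (by exact_mod_cast hN)]
  exact exp_log_two_mul_le hN

lemma lt_two_pow_log_succ (N : ℕ) : N < 2 ^ (Nat.log 2 N + 1) :=
  Nat.lt_pow_succ_log_self (by norm_num) N

lemma log_le_log_two_mul {N : ℕ} (hN : 1 ≤ N) :
    Real.log N ≤ Real.log 2 * (Nat.log 2 N + 1 : ℕ) := by
  rw [Real.log_le_iff_le_exp (by exact_mod_cast hN), ← two_pow_eq_exp]
  exact_mod_cast (lt_two_pow_log_succ N).le

end DyadicScale

/-! ### Chains of seen words and the lower bound for the estimator -/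

section Lower

variable {A : Type*}

/-- The length that remains of a word of length `l` once a decoupling gap is removed. -/
noncomputable def keptLength (ε C : ℝ) (l : ℕ) : ℕ := l - ⌈ε * l + C⌉₊

lemma prefixDetermined_seenIn (N n : ℕ) (x : ℕ → A) :
    PrefixDetermined {y | SeenIn N n y x} := by
  have := PrefixDetermined.firstWord_mem {a : Fin n → A | x ∉ unseenEvent a N}
  simpa only [Set.mem_ofPred_eq, notMem_unseenEvent_iff] using this

/-- The parsing produces a chain of seen words. -/
lemma mem_chainEvent_of_parse {N m K : ℕ} {x y : ℕ → A} {ε C : ℝ} (hN : 1 ≤ N)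
    (hNm : N ≤ 2 ^ (m + 1)) (hε : 0 < ε) (hC : 0 ≤ C) (hm : 1 ≤ m) (hK : 1 ≤ K)
    (hmatch : ∀ p < 2 ^ (m + 1), ∀ l, SeenIn (2 ^ (m + 1)) l (shift^[p] y) x → l ≤ K * m)
    (hletters : ∀ p, SeenIn N 1 (shift^[p] y) x) :
    y ∈ chainEvent (fun l => {y | SeenIn (2 ^ (m + 1)) (keptLength ε C l) y x}) ((K + 1) * m)
      (wordCount N y x - 1) (N - (K * m + 1)) := by
  have hΛ : ∀ p < N, matchLength N (shift^[p] y) x ≤ K * m := fun p hp =>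
    matchLength_le (Nat.mul_pos hK hm) fun l hl =>
      hmatch p (by omega) l (hl.mono hNm (le_refl l))
  have hend := le_parseEnd_pred_add hN hΛ
  refine chainEvent_anti _ _ _ (by omega : _ ≤ parseEnd N y x (wordCount N y x - 1)) ?_
  refine (mem_chainEvent (L := parseEnd N y x) (y := y) (wordCount N y x - 1)
    fun i hi => ?_).1
  have hlt := parseEnd_lt (N := N) (y := y) (x := x) (i := i) (by omega)
  have hs := parseEnd_succ (N := N) (y := y) (x := x) (i := i) (by omega)
  have hle := hΛ _ hlt
  refine ⟨by omega, ?_, ?_⟩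
  · have : (K + 1) * m = K * m + m := by ring
    omega
  · rw [hs, show ∀ a b : ℕ, a + b + 1 - a = b + 1 by omega]
    refine (seenIn_matchLength (hletters _)).mono hNm ?_
    -- The removed gap has at least one letter, so it includes the final letter, which is not part
    -- of the match.
    have : 1 ≤ ⌈ε * (matchLength N (shift^[parseEnd N y x i] y) x + 1 : ℕ) + C⌉₊ :=
      Nat.one_le_ceil_iff.2 (by positivity)
    rw [keptLength]
    omega

lemma mzmEstimator_nonneg (N : ℕ) (y x : ℕ → A) : 0 ≤ mzmEstimator N y x := by
  unfold mzmEstimator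
  split_ifs with h
  · exact le_top
  · rw [EReal.coe_nonneg]
    have h1 : (wordCount N y x : ℝ) ≤ N := by exact_mod_cast wordCount_le N y x
    exact div_nonneg (mul_nonneg (Nat.cast_nonneg _) (Real.log_natCast_nonneg N)) (by linarith)

lemma le_mzmEstimator {N : ℕ} {y x : ℕ → A} {s : ℝ} (hs : 0 ≤ s)
    (h : s * N < wordCount N y x * Real.log N) : (s : EReal) ≤ mzmEstimator N y x := by
  unfold mzmEstimator
  split_ifs with h0
  · exact le_top
  · rw [EReal.coe_le_coe_iff]
    have h1 : (wordCount N y x : ℝ) < N := by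
      exact_mod_cast lt_of_le_of_ne (wordCount_le N y x) h0
    rw [le_div_iff₀ (by linarith)]
    have : 0 ≤ s * wordCount N y x := by positivity
    linarith

variable [Fintype A] [MeasurableSpace A] [DiscreteMeasurableSpace A]
  {P Q : Measure (ℕ → A)} [IsProbabilityMeasure P] [IsProbabilityMeasure Q]

/-- Prefixes of seen words are seen, so the end of a word may be given up as decoupling gap; this
only degrades the rate from `t` to `(t + ε)(1 - ε)` and costs a constant. -/
lemma exists_real_seenIn_inter_le (hinv : MeasurePreserving shift Q Q) (hQ : UpperDecoupled Q)
    {ε : ℝ} (hε : 0 < ε) (hε2 : ε ≤ 1 / 2) :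
    ∃ C : ℝ, 0 ≤ C ∧ ∀ (x : ℕ → A) (N K : ℕ) (b t : ℝ), 0 ≤ b → t + ε ≤ 0 →
      (∀ n ≤ K, Q.real {y | SeenIn N n y x} ≤ Real.exp (b + t * n)) →
      ∀ l ∈ Finset.Icc 1 K, ∀ E, PrefixDetermined E →
        Q.real ({y | SeenIn N (keptLength ε C l) y x} ∩ shift^[l] ⁻¹' E) ≤
          Real.exp (b + (-t * (2 * (C + 1)) + C)) * Real.exp ((t + ε) * (1 - ε) * l) *
            Q.real E := by
  obtain ⟨C, hC0, hC⟩ := hQ.exists_real_inter_le hinv hε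
  refine ⟨C, hC0, fun x N K b t hb ht hx l hl E hE => ?_⟩
  have hlK := (Finset.mem_Icc.1 hl).2
  have hceil := Nat.ceil_lt_add_one (a := ε * l + C) (by positivity)
  have hceil' := Nat.le_ceil (ε * l + C)
  set g := ⌈ε * l + C⌉₊ with hg
  set n := keptLength ε C l with hn
  have hn' : n = l - g := rfl
  have hl0 : (0 : ℝ) ≤ l := Nat.cast_nonneg l
  rw [← Real.exp_add]
  -- A word consumed entirely by its gap has `l ≤ 2(C + 1)`, because `ε ≤ 1/2`; the constant factor
  -- pays for it.
  by_cases h0 : l ≤ g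
  · have h1 : (l : ℝ) ≤ g := by exact_mod_cast h0
    have h2 : (l : ℝ) ≤ 2 * (C + 1) := by nlinarith
    calc Q.real ({y | SeenIn N n y x} ∩ shift^[l] ⁻¹' E)
        ≤ Q.real (shift^[l] ⁻¹' E) := measureReal_mono Set.inter_subset_right
      _ = Q.real E := real_preimage_shift hinv _ hE.measurableSet
      _ ≤ _ := by
          refine le_mul_of_one_le_left measureReal_nonneg (Real.one_le_exp ?_)
          have h3 : (t + ε) * (1 - ε) ≥ t := by nlinarith
          have h4 : t * l ≤ (t + ε) * (1 - ε) * l := by gcongr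
          have h5 : t * (2 * (C + 1)) ≤ t * l := mul_le_mul_of_nonpos_left h2 (by linarith)
          linarith
  · have hle : n ≤ l := Nat.sub_le _ _
    have hnl : n + g = l := by omega
    have hnr : (n : ℝ) + g = l := by exact_mod_cast hnl
    have hset : {y | SeenIn N n y x} =
        {y | firstWord y n ∈ {a : Fin n → A | x ∉ unseenEvent a N}} := by
      ext y
      simp only [Set.mem_ofPred_eq, notMem_unseenEvent_iff]
    have key := hC n g (by
      have : ε * n ≤ ε * l := by gcongr
      linarith) {a : Fin n → A | x ∉ unseenEvent a N} E hE
    rw [← hset, hnl] at key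
    refine key.trans ?_
    rw [← mul_assoc]
    refine mul_le_mul_of_nonneg_right ?_ measureReal_nonneg
    refine (mul_le_mul_of_nonneg_left (hx n (by omega)) (Real.exp_nonneg _)).trans ?_
    rw [← Real.exp_add]
    refine Real.exp_le_exp.2 ?_
    have h1 : l - (ε * l + C + 1) ≤ (n : ℝ) := by linarith
    have h2 : (t + ε) * n ≤ (t + ε) * (l - (ε * l + C + 1)) := mul_le_mul_of_nonpos_left h1 ht
    have h3 : 0 ≤ ε * (C + 1) := by positivity
    have h4 : 0 ≤ -t * (C + 1) := mul_nonneg (by linarith) (by linarith)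
    nlinarith

/-- There are finitely many letters of positive probability, so all of them eventually pass the
threshold of `ae_eventually_seen`. This makes the convention `max 1` in the match length harmless.
-/
lemma ae_eventually_letters_seen (hP : MeasurePreserving shift P P)
    (hQ : MeasurePreserving shift Q Q) (hPsld : SelectivelyLowerDecoupled P)
    (hsupp : seqSupport Q ⊆ seqSupport P) :
    ∀ᵐ xy ∂(P.prod Q), ∀ᶠ m : ℕ in atTop, ∀ p, SeenIn (2 ^ m) 1 (shift^[p] xy.2) xy.1 := by
  have h1 := hPsld.ae_eventually_seen hP 1 (δ := 1 / 2) (by norm_num) (by norm_num)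
  have h2 : ∀ᵐ y ∂Q, ∀ p, shift^[p] y ∈ seqSupport Q := ae_all_iff.2 fun p =>
    (hQ.iterate p).quasiMeasurePreserving.ae (ae_wordProb_firstWord_pos Q)
  have h3 : ∀ᶠ m : ℕ in atTop, ∀ a : Fin 1 → A, 0 < wordProb P a →
      Real.exp (-((1 - 1 / 2) * Real.log 2 * m)) ≤ wordProb P a := by
    refine eventually_all.2 fun a => ?_
    by_cases ha : 0 < wordProb P a
    · have hr : 0 < (1 - 1 / 2) * Real.log 2 := mul_pos (by norm_num) (Real.log_pos (by norm_num))
      have hlim : Tendsto (fun m : ℕ => Real.exp (-((1 - 1 / 2) * Real.log 2 * m))) atTop (𝓝 0) :=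
        Real.tendsto_exp_neg_atTop_nhds_zero.comp
          (tendsto_natCast_atTop_atTop.const_mul_atTop hr)
      filter_upwards [hlim.eventually_lt_const ha] with m hm _ using hm.le
    · exact Eventually.of_forall fun m h => absurd h ha
  filter_upwards [Measure.quasiMeasurePreserving_fst.ae h1,
    Measure.quasiMeasurePreserving_snd.ae h2] with xy hx hy
  filter_upwards [hx, h3, eventually_ge_atTop 1] with m hm1 hm2 hm3 p
  rw [← notMem_unseenEvent_iff]
  exact hm1 1 (le_refl 1) (by omega) _ (hm2 _ (hsupp (hy p) 1))

/-- The arithmetic of the exponents in the lower bound. -/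
lemma eventually_chain_bound_le {s β t ε κ η C : ℝ} (hs : 0 < s) (hβ : 0 < β)
    (hη : η = Real.log 2 * κ / (16 * s)) (hκ : 0 < κ) (hκt : t = -(β * s) - κ)
    (hεt : ε * (1 - t) ≤ κ / 8) (K K' : ℕ) :
    ∀ᶠ N : ℕ in atTop, ∀ c : ℕ, c * Real.log N ≤ s * N →
      (((K * Nat.log 2 N : ℕ) : ℝ) *
        Real.exp ((β * Real.log 2 + η) * Nat.log 2 N + C)) ^ c *
        Real.exp ((t + ε) * (1 - ε) * (N - (K' * Nat.log 2 N + 1) : ℕ)) ≤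
      Real.exp (-(κ / 2 * N)) := by
  set r := Real.log 2 with hr
  have hr0 : 0 < r := Real.log_pos (by norm_num)
  have hη0 : 0 < η := by rw [hη]; positivity
  have ht0 : 0 ≤ -t := by rw [hκt]; have : 0 < β * s := by positivity
                          linarith
  have e1 := tendsto_log_two_atTop.eventually
    (eventually_linear_le_mul_exp hη0 one_pos K)
  have e2 := tendsto_log_two_atTop.eventually
    (eventually_linear_le_mul_exp hr0 (by positivity : 0 < κ / 8) (-t * (K' + 1)))
  have e3 := tendsto_log_two_atTop.eventually (eventually_ge_atTop ⌈C / η⌉₊)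
  filter_upwards [e1, e2, e3, eventually_ge_atTop 1] with N h1 h2 h3 hN c hc
  set m := Nat.log 2 N with hm
  have hm0 : (0 : ℝ) ≤ m := Nat.cast_nonneg m
  have hNm := exp_log_two_mul_le hN
  have hlog := log_two_mul_le_log hN
  rw [← hr, ← hm] at hNm hlog
  have hC : C ≤ η * m := by
    have : C / η ≤ m := (Nat.le_ceil _).trans (by exact_mod_cast h3)
    rwa [div_le_iff₀' hη0] at this
  have hK : ((K * m : ℕ) : ℝ) ≤ Real.exp (η * m) := by
    push_cast
    have : (0 : ℝ) ≤ K := Nat.cast_nonneg K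
    linarith
  -- The choice of length and the constant `C` each cost one more `η`. By the choice of `η`, three
  -- of them over `c` words cost at most `3κ/16` per letter of `N`.
  have hbase : ((K * m : ℕ) : ℝ) * Real.exp ((β * r + η) * m + C) ≤
      Real.exp ((β * r + 3 * η) * m) := by
    calc ((K * m : ℕ) : ℝ) * Real.exp ((β * r + η) * m + C)
        ≤ Real.exp (η * m) * Real.exp ((β * r + η) * m + C) := by gcongr
      _ = Real.exp (η * m + ((β * r + η) * m + C)) := by rw [← Real.exp_add]
      _ ≤ _ := Real.exp_le_exp.2 (by linarith)
  have hpow : (((K * m : ℕ) : ℝ) * Real.exp ((β * r + η) * m + C)) ^ c ≤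
      Real.exp ((β * s + 3 * κ / 16) * N) := by
    refine (pow_le_pow_left₀ (by positivity) hbase c).trans ?_
    rw [← Real.exp_nat_mul]
    refine Real.exp_le_exp.2 ?_
    have h4 : c * (r * m) ≤ s * N := (mul_le_mul_of_nonneg_left hlog (Nat.cast_nonneg c)).trans hc
    have h5 : η = r * (κ / (16 * s)) := by rw [hη]; ring
    calc (c : ℝ) * ((β * r + 3 * η) * m) = (β + 3 * (κ / (16 * s))) * (c * (r * m)) := by
          rw [h5]; ring
      _ ≤ (β + 3 * (κ / (16 * s))) * (s * N) := by gcongr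
      _ = _ := by field_simp
  have ht' : (t + ε) * (1 - ε) ≤ t + κ / 8 := by
    have e : (t + ε) * (1 - ε) = t + ε * (1 - t) - ε ^ 2 := by ring
    linarith [sq_nonneg ε]
  have hexp : (t + ε) * (1 - ε) * (N - (K' * m + 1) : ℕ) ≤ (t + κ / 4) * N := by
    have h6 : (N : ℝ) ≤ (N - (K' * m + 1) : ℕ) + (K' * m + 1) := by
      exact_mod_cast (by omega : N ≤ (N - (K' * m + 1)) + (K' * m + 1))
    have h7 : ((N - (K' * m + 1) : ℕ) : ℝ) ≤ N := by exact_mod_cast Nat.sub_le _ _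
    have h8 : -t * (K' * m + 1) ≤ κ / 8 * N := by
      have : -t * (K' * m + 1) ≤ -t * (K' + 1) * m + -t * (K' + 1) := by
        have h9 : 0 ≤ -t * m := mul_nonneg ht0 hm0
        have h10 : 0 ≤ -t * K' := mul_nonneg ht0 (Nat.cast_nonneg K')
        have e : -t * (K' + 1) * m + -t * (K' + 1) - -t * (K' * m + 1) = -t * m + -t * K' := by
          ring
        linarith
      exact this.trans (h2.trans (mul_le_mul_of_nonneg_left hNm (by positivity)))
    have h11 : (0 : ℝ) ≤ (N - (K' * m + 1) : ℕ) := Nat.cast_nonneg _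
    have h12 : (t + ε) * (1 - ε) * (N - (K' * m + 1) : ℕ) ≤
      (t + κ / 8) * (N - (K' * m + 1) : ℕ) := mul_le_mul_of_nonneg_right ht' h11
    have h13 : t * (N - (K' * m + 1) : ℕ) ≤ t * N + -t * (K' * m + 1) := by
      have := mul_le_mul_of_nonneg_left h6 ht0
      rw [mul_add] at this
      linarith
    have h14 : κ / 8 * (N - (K' * m + 1) : ℕ) ≤ κ / 8 * N :=
      mul_le_mul_of_nonneg_left h7 (by positivity)
    rw [add_mul] at h12 ⊢
    linarith
  calc _ ≤ Real.exp ((β * s + 3 * κ / 16) * N) * Real.exp ((t + κ / 4) * N) := by gcongr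
    _ = Real.exp (-(9 * κ / 16 * N)) := by rw [← Real.exp_add, hκt]; congr 1; ring
    _ ≤ _ := by
      refine Real.exp_le_exp.2 ?_
      have : 0 ≤ κ * N := by positivity
      linarith

/-- If `c ln N ≤ sN`, then `y` begins with a chain of at most that many words, each nearly seen in
`x`, covering all but `O(ln N)` of the `N` letters. For typical `x` this has `Q`-probability
exponentially small in `N`. -/
theorem ae_eventually_le_mzmEstimator (hPinv : MeasurePreserving shift P P)
    (hQinv : MeasurePreserving shift Q Q) (hPsld : SelectivelyLowerDecoupled P)
    (hQud : UpperDecoupled Q) (hnd : Nondegenerate P Q) (hsupp : seqSupport Q ⊆ seqSupport P)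
    {s β : ℝ} (hβ : 0 < β) (hβ1 : β ≤ 1) (hs : pressure P Q (-β) < ((-(β * s) : ℝ) : EReal)) :
    ∀ᵐ xy ∂(P.prod Q), ∀ᶠ N : ℕ in atTop, (s : EReal) ≤ mzmEstimator N xy.2 xy.1 := by
  rcases le_or_gt s 0 with hs0 | hs0
  · refine Eventually.of_forall fun xy => Eventually.of_forall fun N => ?_
    exact le_trans (by exact_mod_cast hs0) (mzmEstimator_nonneg N xy.2 xy.1)
  obtain ⟨t, ht1, ht2⟩ := EReal.lt_iff_exists_real_btwn.1 hs
  rw [EReal.coe_lt_coe_iff] at ht2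
  -- The surplus exponent `κ` is the error budget; `η` and `ε` are small fractions of it.
  set κ := -(β * s) - t with hκ
  have hκ0 : 0 < κ := by linarith
  have hβs : 0 < β * s := by positivity
  set r := Real.log 2 with hr
  have hr0 : 0 < r := Real.log_pos (by norm_num)
  set η := r * κ / (16 * s) with hη
  have hη0 : 0 < η := by positivity
  set ε := κ / (8 * (1 - t)) with hε
  have h1t : 0 < 1 - t := by linarith
  have hε0 : 0 < ε := by positivity
  have hεt : ε * (1 - t) = κ / 8 := by rw [hε]; field_simp
  have hε8 : ε ≤ 1 / 8 := by
    rw [hε, div_le_iff₀ (by positivity)]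
    linarith
  have htε : t + ε ≤ 0 := by nlinarith
  obtain ⟨K, hK1, hmatch⟩ := hnd.exists_ae_eventually_seenIn_le hPinv hQinv
  obtain ⟨C, hC0, hseen⟩ := exists_ae_eventually_real_seenIn_le (K := K + 1) hPinv hsupp hβ hβ1
    ht1 hη0
  obtain ⟨C', hC'0, hdec⟩ := exists_real_seenIn_inter_le hQinv hQud hε0 (by linarith)
  set G : (ℕ → A) → ℕ → ℕ → Set (ℕ → A) := fun x m l =>
    {y | SeenIn (2 ^ (m + 1)) (keptLength ε C' l) y x} with hG
  set bad : ℕ → Set ((ℕ → A) × (ℕ → A)) := fun N =>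
    ⋃ c ∈ (Finset.range (N + 1)).filter (fun c : ℕ => c * Real.log N ≤ s * N),
      {xy | xy.2 ∈ chainEvent (G xy.1 (Nat.log 2 N)) ((K + 1) * Nat.log 2 N) c
        (N - (K * Nat.log 2 N + 1))} with hbad
  have hbadmeas : ∀ N, MeasurableSet (bad N) := fun N =>
    Finset.measurableSet_biUnion _ fun c _ =>
      measurableSet_setOf_chainEvent (G := fun x => G x (Nat.log 2 N))
        (fun l => measurableSet_seenIn _ _) _ _ _
  have hae : ∀ᵐ xy ∂(P.prod Q), ∀ᶠ N in atTop, xy ∉ bad N := by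
    -- Measurability allows fixing a typical `x` first and applying Borel–Cantelli in `y` alone.
    have hmeas : MeasurableSet {xy | ∀ᶠ N in atTop, xy ∉ bad N} := by
      have := MeasurableSet.measurableSet_liminf fun N => (hbadmeas N).compl
      convert! this using 1
      ext xy
      rw [Filter.mem_liminf_iff_eventually_mem]
      rfl
    rw [Measure.ae_prod_iff_ae_ae hmeas]
    filter_upwards [hseen] with x hx
    refine ae_eventually_notMem_of_summable (s := fun N => Prod.mk x ⁻¹' bad N)
      (summable_exp_neg_mul (a := κ / 4) (by positivity)) ?_
    filter_upwards [tendsto_log_two_atTop.eventually hx,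
      eventually_chain_bound_le (C := C + (-t * (2 * (C' + 1)) + C')) hs0 hβ hη hκ0
        (by rw [hκ]; ring) hεt.le (K + 1) K,
      eventually_linear_le_mul_exp (a := κ / 4) (by positivity) one_pos 1] with N h1 h2 h3
    set m := Nat.log 2 N with hm
    have hbadx : Prod.mk x ⁻¹' bad N =
        ⋃ c ∈ (Finset.range (N + 1)).filter (fun c : ℕ => c * Real.log N ≤ s * N),
          chainEvent (G x m) ((K + 1) * m) c (N - (K * m + 1)) := by
      ext y; simp [hbad, hm]
    have hterm : ∀ c ∈ (Finset.range (N + 1)).filter (fun c : ℕ => c * Real.log N ≤ s * N),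
        Q.real (chainEvent (G x m) ((K + 1) * m) c (N - (K * m + 1))) ≤
          Real.exp (-(κ / 2 * N)) := by
      intro c hc
      refine le_trans ?_ (h2 c (Finset.mem_filter.1 hc).2)
      refine real_chainEvent_le (fun l => prefixDetermined_seenIn _ _ x) (Real.exp_nonneg _)
        (mul_nonpos_of_nonpos_of_nonneg htε (by linarith)) ?_ c _
      have := hdec x (2 ^ (m + 1)) ((K + 1) * m) ((β * r + η) * m + C) t (by positivity) htε
        fun n hn => (h1 n hn).trans_eq (by congr 1; ring)
      rwa [add_assoc] at this
    rw [hbadx]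
    refine (measureReal_biUnion_finset_le _ _).trans ((Finset.sum_le_sum hterm).trans ?_)
    rw [Finset.sum_const, nsmul_eq_mul]
    have hcard : ((Finset.filter (fun c : ℕ => c * Real.log N ≤ s * N)
        (Finset.range (N + 1))).card : ℝ) ≤ N + 1 := by
      have := Finset.card_filter_le (Finset.range (N + 1))
        (fun c : ℕ => c * Real.log N ≤ s * N)
      rw [Finset.card_range] at this
      exact_mod_cast this
    calc _ ≤ Real.exp (κ / 4 * N) * Real.exp (-(κ / 2 * N)) := by
          gcongr
          linarith
      _ = _ := by rw [← Real.exp_add]; congr 1; ring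
  filter_upwards [hae, hmatch, ae_eventually_letters_seen hPinv hQinv hPsld hsupp]
    with xy h1 h2 h3
  filter_upwards [h1, tendsto_log_two_atTop.eventually h2, tendsto_log_two_atTop.eventually h3,
    tendsto_log_two_atTop.eventually (eventually_ge_atTop 1), eventually_ge_atTop 1]
    with N hN1 hN2 hN3 hm hN
  refine le_mzmEstimator hs0.le ?_
  by_contra hle
  rw [not_lt] at hle
  refine hN1 ?_
  simp only [hbad, Set.mem_iUnion]
  -- The last word may be truncated, so it is left out of the chain.
  refine ⟨wordCount N xy.2 xy.1 - 1, ?_, ?_⟩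
  · have hc := wordCount_le N xy.2 xy.1
    refine Finset.mem_filter.2 ⟨Finset.mem_range.2 (by omega), le_trans ?_ hle⟩
    refine mul_le_mul_of_nonneg_right ?_ (Real.log_natCast_nonneg N)
    exact_mod_cast Nat.sub_le _ _
  · exact mem_chainEvent_of_parse hN (lt_two_pow_log_succ N).le hε0 hC'0 hm hK1 hN2
      fun p => (hN3 p).mono (Nat.pow_log_le_self 2 (by omega)) (le_refl 1)

end Lower

/-! ### The upper bound -/

section UpperCombinatorics

variable {A : Type*}

lemma lt_of_lt_mzmEstimator {N : ℕ} {y x : ℕ → A} {s : ℝ} (hN : 2 ≤ N)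
    (h : (s : EReal) < mzmEstimator N y x) :
    s * (N - wordCount N y x) < wordCount N y x * Real.log N := by
  unfold mzmEstimator at h
  split_ifs at h with h0
  · rw [h0, sub_self, mul_zero]
    have hN' : (1 : ℝ) < N := by exact_mod_cast hN
    exact mul_pos (by linarith) (Real.log_pos hN')
  · have h1 : (wordCount N y x : ℝ) < N := by
      exact_mod_cast lt_of_le_of_ne (wordCount_le N y x) h0
    rwa [EReal.coe_lt_coe_iff, lt_div_iff₀ (by linarith)] at h

lemma sum_range_two_mul (l : ℕ → ℕ) (j : ℕ) :
    ∑ k ∈ Finset.range (2 * j), l k =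
      ∑ k ∈ Finset.range j, l (2 * k) + ∑ k ∈ Finset.range j, l (2 * k + 1) := by
  induction j with
  | zero => simp
  | succ j ih =>
    rw [show 2 * (j + 1) = 2 * j + 1 + 1 by ring, Finset.sum_range_succ, Finset.sum_range_succ, ih,
      Finset.sum_range_succ, Finset.sum_range_succ]
    ring

/-- Every second one of the words can serve as a gap, and one of the two parities has words of
total length at most `N / 2`. -/
lemma exists_shift_mem_gapChainEvent {G : ℕ → Set (ℕ → A)} {I : Finset ℕ} {d₀ j N : ℕ}
    {y : ℕ → A} {p l : ℕ → ℕ}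
    (h : ∀ k < 2 * j + 1, l k ∈ I ∧ d₀ ≤ l k ∧ p k + l k ≤ p (k + 1) ∧ shift^[p k] y ∈ G (l k))
    (hN : p (2 * j + 1) ≤ N) :
    ∃ o ≤ N, shift^[o] y ∈ gapChainEvent G I d₀ j (N / 2) N := by
  have hsum : ∀ n ≤ 2 * j + 1, ∑ k ∈ Finset.range n, l k ≤ p n := by
    intro n hn
    induction n with
    | zero => simp
    | succ n ih =>
      rw [Finset.sum_range_succ]
      have := ih (by omega)
      have := (h n (by omega)).2.2.1
      omega
  have h1 := hsum (2 * j) (by omega)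
  have h2 := (h (2 * j) (by omega)).2.2.1
  -- Words `0, …, 2j - 1` split by parity; the extra word `2j` is the gap after the last odd one.
  rw [sum_range_two_mul] at h1
  rcases le_total (∑ k ∈ Finset.range j, l (2 * k)) (∑ k ∈ Finset.range j, l (2 * k + 1))
    with hle | hle
  · obtain ⟨h3, h4⟩ := mem_gapChainEvent (G := G) (I := I) (d₀ := d₀) (y := y)
      (p := fun k => p (2 * k)) (l := fun k => l (2 * k)) j (N / 2) N (fun k hk => by
        obtain ⟨a1, a2, a3, a4⟩ := h (2 * k) (by omega)
        obtain ⟨b1, b2, b3, b4⟩ := h (2 * k + 1) (by omega)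
        refine ⟨a1, ?_, a4⟩
        rw [show 2 * (k + 1) = 2 * k + 1 + 1 by ring]
        omega) (by omega) (by omega)
    exact ⟨p (2 * 0), by omega, h3⟩
  · obtain ⟨h3, h4⟩ := mem_gapChainEvent (G := G) (I := I) (d₀ := d₀) (y := y)
      (p := fun k => p (2 * k + 1)) (l := fun k => l (2 * k + 1)) j (N / 2) N (fun k hk => by
        obtain ⟨a1, a2, a3, a4⟩ := h (2 * k + 1) (by omega)
        obtain ⟨b1, b2, b3, b4⟩ := h (2 * k + 1 + 1) (by omega)
        refine ⟨a1, ?_, a4⟩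
        rw [show 2 * (k + 1) + 1 = 2 * k + 1 + 1 + 1 by ring]
        omega) (by omega) (by omega)
    exact ⟨p (2 * 0 + 1), by omega, h3⟩

lemma parseEnd_monotone (N : ℕ) (y x : ℕ → A) : Monotone (parseEnd N y x) := by
  refine monotone_nat_of_le_succ fun i => ?_
  have := parseEnd_le N y x i
  rw [parseEnd]
  omega

open Classical in
/-- If the parsing has many words and few of them are short, then it contains a long chain of words
separated by gaps. -/
lemma exists_gapChain_of_parse {N j K d₀ b : ℕ} {x y : ℕ → A} {G : ℕ → Set (ℕ → A)}
    (hK : ∀ p < N, matchLength N (shift^[p] y) x + 1 ≤ K)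
    (hG : ∀ p < N, ∀ l, 1 ≤ l → l ≤ K → ¬ SeenIn N l (shift^[p] y) x → shift^[p] y ∈ G l)
    (hGmono : ∀ l l', l ≤ l' → G l ⊆ G l')
    (hb : ((Finset.range N).filter (fun p => shift^[p] y ∈ G d₀)).card ≤ b)
    (hc : 2 * j + 3 + b ≤ wordCount N y x) :
    ∃ o ≤ N, shift^[o] y ∈ gapChainEvent G (Finset.Icc d₀ K) d₀ j (N / 2) N := by
  set L := parseEnd N y x with hL
  set c := wordCount N y x with hcdef
  have hlt : ∀ i < c, L i < N := fun i hi => parseEnd_lt hi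
  have hsucc : ∀ i < c - 1, L (i + 1) = L i + (matchLength N (shift^[L i] y) x + 1) :=
    fun i hi => parseEnd_succ (by omega)
  have hmono : Monotone L := parseEnd_monotone N y x
  have hword : ∀ i < c - 1, shift^[L i] y ∈ G (L (i + 1) - L i) := by
    intro i hi
    rw [hsucc i hi, Nat.add_sub_cancel_left]
    exact hG _ (hlt i (by omega)) _ (by omega) (hK _ (hlt i (by omega)))
      (not_seenIn_matchLength_succ N _ x)
  have hinj : Set.InjOn L (Finset.range (c - 1)) := by
    have hstrict : ∀ i k, i < k → k < c - 1 → L i < L k := by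
      intro i k hik hk
      have h1 := hsucc i (by omega)
      have h2 := hmono (show i + 1 ≤ k by omega)
      omega
    intro i hi k hk hik
    simp only [Finset.coe_range, Set.mem_Iio] at hi hk
    rcases lt_trichotomy i k with h | h | h
    · have := hstrict i k h hk; omega
    · exact h
    · have := hstrict k i h hi; omega
  set S := (Finset.range (c - 1)).filter (fun i => d₀ ≤ L (i + 1) - L i) with hS
  -- The starting points of short words are distinct positions, and monotonicity of `G` puts each of
  -- them among those counted by `b`.
  have hshort : ((Finset.range (c - 1)).filter (fun i => ¬ d₀ ≤ L (i + 1) - L i)).card ≤ b := by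
    refine le_trans (Finset.card_le_card_of_injOn L ?_ (hinj.mono ?_)) hb
    · intro i hi
      simp only [Finset.coe_filter, Finset.mem_range, Set.mem_ofPred_eq] at hi ⊢
      exact ⟨hlt i (by omega), hGmono _ _ (by omega) (hword i hi.1)⟩
    · exact_mod_cast Finset.filter_subset _ _
  -- Besides the `2j + 1` words needed for the chain, one more marks where the last of them must
  -- have ended.
  have hcard : 2 * j + 2 ≤ S.card := by
    have := Finset.card_filter_add_card_filter_not (s := Finset.range (c - 1))
      (fun i => d₀ ≤ L (i + 1) - L i)
    rw [Finset.card_range, ← hS] at this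
    omega
  obtain ⟨T, hTS, hT⟩ := Finset.exists_subset_card_eq hcard
  set e := T.orderEmbOfFin hT with he
  -- Increasing enumeration of the selected long words; the value `0` is never used. Skipped short
  -- words become part of the gaps.
  set q : ℕ → ℕ := fun k => if h : k < 2 * j + 2 then e ⟨k, h⟩ else 0 with hq
  have hqmem : ∀ k < 2 * j + 2, q k < c - 1 ∧ d₀ ≤ L (q k + 1) - L (q k) := by
    intro k hk
    have h1 : q k ∈ T := by
      simp only [hq, hk, dite_true]
      exact Finset.orderEmbOfFin_mem T hT _
    simpa [hS] using hTS h1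
  have hqlt : ∀ k < 2 * j + 1, q k < q (k + 1) := by
    intro k hk
    simp only [hq, show k < 2 * j + 2 by omega, show k + 1 < 2 * j + 2 by omega, dite_true]
    exact e.strictMono (by simp)
  refine exists_shift_mem_gapChainEvent (p := fun k => L (q k))
    (l := fun k => L (q k + 1) - L (q k)) (fun k hk => ?_)
    (hlt _ (by have := (hqmem (2 * j + 1) (by omega)).1; omega)).le
  obtain ⟨h1, h2⟩ := hqmem k (by omega)
  have h3 := hsucc _ h1
  have h4 := hK _ (hlt (q k) (by omega))
  have h5 := hmono (show q k + 1 ≤ q (k + 1) from hqlt k hk)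
  exact ⟨Finset.mem_Icc.2 ⟨h2, by omega⟩, h2, by omega, hword _ h1⟩

end UpperCombinatorics

/-! ### Markov and Chernoff bounds for improbable words -/

section UpperProbability

/-- Markov's inequality for the number of events that occur; no independence is needed. -/
lemma real_setOf_le_card_le {Ω : Type*} [MeasurableSpace Ω] {μ : Measure Ω} [IsFiniteMeasure μ]
    {s : Finset ℕ} {E : ℕ → Set Ω} [∀ y, DecidablePred fun p => y ∈ E p]
    (hE : ∀ p ∈ s, MeasurableSet (E p)) {c : ℝ} (hc : 0 < c) :
    μ.real {y | c ≤ ((s.filter fun p => y ∈ E p).card : ℝ)} ≤ (∑ p ∈ s, μ.real (E p)) / c := by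
  set f : Ω → ℝ := fun y => ∑ p ∈ s, (E p).indicator (fun _ => (1 : ℝ)) y with hf
  have hfe : ∀ y, f y = ((s.filter fun p => y ∈ E p).card : ℝ) := by
    intro y
    rw [hf, Finset.card_filter]
    push_cast
    exact Finset.sum_congr rfl fun p _ => by simp [Set.indicator_apply]
  have hint : ∀ p ∈ s, Integrable ((E p).indicator (fun _ => (1 : ℝ))) μ := fun p hp =>
    (integrable_const 1).indicator (hE p hp)
  have h1 := mul_meas_ge_le_integral_of_nonneg (μ := μ) (f := f)
    (Eventually.of_forall fun y => by rw [hfe]; exact Nat.cast_nonneg _)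
    (integrable_finsetSum s hint) c
  rw [le_div_iff₀ hc, mul_comm]
  simp only [hfe] at h1
  refine h1.trans_eq ?_
  rw [integral_congr_ae (Eventually.of_forall fun y => (hfe y).symm), integral_finsetSum s hint]
  exact Finset.sum_congr rfl fun p hp => by
    rw [integral_indicator_const _ (hE p hp)]; simp

variable {A : Type*} [MeasurableSpace A]

/-- The `P`-probability of the prefix of length `l` is at most `c`. -/
def improbableEvent (P : Measure (ℕ → A)) (c : ℝ) (l : ℕ) : Set (ℕ → A) :=
  {y | firstWord y l ∈ {a : Fin l → A | wordProb P a ≤ c}}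

lemma improbableEvent_mono (P : Measure (ℕ → A)) [IsProbabilityMeasure P] (c : ℝ) {l l' : ℕ}
    (h : l ≤ l') : improbableEvent P c l ⊆ improbableEvent P c l' := by
  intro y hy
  refine le_trans (measureReal_mono ?_) hy
  intro z hz
  refine firstWord_eq_iff.2 fun i => ?_
  exact congrFun (show firstWord z l' = firstWord y l' from hz) ⟨i, by omega⟩

variable [Fintype A] [DiscreteMeasurableSpace A] {P Q : Measure (ℕ → A)} [IsProbabilityMeasure Q]

/-- Chernoff's inequality: `(c / P[a])^α ≥ 1` on the words that count. -/
lemma real_improbableEvent_le (hsupp : seqSupport Q ⊆ seqSupport P) (l : ℕ) {α c : ℝ}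
    (hα : 0 < α) (hc : 0 < c) :
    Q.real (improbableEvent P c l) ≤ c ^ α * crossSum P Q l α := by
  classical
  unfold improbableEvent
  rw [real_firstWord_mem]
  unfold crossSum
  rw [Finset.mul_sum, Finset.sum_filter, Finset.sum_filter]
  refine Finset.sum_le_sum fun a _ => ?_
  have hnn := wordProb_nonneg Q a
  have hpn := Real.rpow_nonneg (wordProb_nonneg P a) (-α)
  have hcn := Real.rpow_nonneg hc.le α
  by_cases ha : a ∈ wordSupport P l
  · rw [if_pos ha]
    split_ifs with h
    · rw [← mul_assoc]
      refine le_mul_of_one_le_left hnn ?_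
      have ha' : 0 < wordProb P a := ha
      rw [Real.rpow_neg ha'.le, ← div_eq_mul_inv, ← Real.div_rpow hc.le ha'.le]
      exact Real.one_le_rpow ((one_le_div ha').2 h) hα.le
    · positivity
  · have h0 : wordProb Q a = 0 := by
      by_contra h0
      exact ha (wordProb_pos_of_seqSupport_subset hsupp (lt_of_le_of_ne hnn (Ne.symm h0)))
    simp [h0]

end UpperProbability


/-! ### Asymptotic arithmetic for the upper bound -/

section UpperEstimates

/-- A large value of the estimator forces a large number of words, even after discarding a few. -/
lemma eventually_two_mul_floor_add_le {s s' a : ℝ} (hs' : 0 < s') (hss : s' < s) (ha : 0 < a)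
    (har : a ≤ Real.log 2) :
    ∀ᶠ N : ℕ in atTop, ∀ c b : ℕ, s * (N - c) < c * Real.log N →
      (b : ℝ) ≤ Real.exp ((Real.log 2 - a) * Nat.log 2 N) →
      2 * ⌊s' * N / (2 * Real.log 2 * (Nat.log 2 N + 1))⌋₊ + 3 + b ≤ c := by
  set r := Real.log 2 with hr
  have hr0 : 0 < r := Real.log_pos (by norm_num)
  have e1 := tendsto_log_two_atTop.eventually
    (eventually_linear_le_mul_exp ha (sub_pos.2 hss) (8 * r))
  have e2 := tendsto_log_two_atTop.eventually
    (eventually_ge_atTop ⌈s * (s + s') / ((s - s') * r)⌉₊)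
  filter_upwards [e1, e2, eventually_ge_atTop 1] with N h1 h2 hN c b hc hb
  set m := Nat.log 2 N with hm
  have hm0 : (0 : ℝ) ≤ m := Nat.cast_nonneg m
  have hNm := exp_log_two_mul_le hN
  have hlog := log_le_log_two_mul hN
  push_cast at hlog
  rw [← hr, ← hm] at hNm hlog
  have hN0 : (0 : ℝ) < N := by exact_mod_cast hN
  set X := r * (m + 1) with hX
  have hX0 : 0 < X := by positivity
  have hs0 : 0 < s := hs'.trans hss
  have hXs : s * (s + s') ≤ (s - s') * X := by
    have h3 : s * (s + s') / ((s - s') * r) ≤ m := (Nat.le_ceil _).trans (by exact_mod_cast h2)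
    rw [div_le_iff₀ (mul_pos (sub_pos.2 hss) hr0)] at h3
    have h4 : 0 ≤ (s - s') * r := mul_nonneg (sub_pos.2 hss).le hr0.le
    have e : (s - s') * X = m * ((s - s') * r) + (s - s') * r := by rw [hX]; ring
    linarith
  have hc' : s * N ≤ c * (X + s) := by
    have h3 : (c : ℝ) * Real.log N ≤ c * X := mul_le_mul_of_nonneg_left hlog (Nat.cast_nonneg c)
    linarith
  -- `X` is an upper bound for `ln N`. The mean of `s` and `s'` splits into `s'` for the chain and
  -- `(s - s')/2` for the discarded words.
  have hclow : (s + s') * N / (2 * X) ≤ c := by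
    rw [div_le_iff₀ (by positivity)]
    have h3 : (s + s') * N * (X + s) ≤ c * (2 * X) * (X + s) := by
      have h4 : (s + s') * (X + s) ≤ 2 * s * X := by
        have e : 2 * s * X - (s + s') * (X + s) = (s - s') * X - s * (s + s') := by ring
        linarith
      calc (s + s') * N * (X + s) = (s + s') * (X + s) * N := by ring
        _ ≤ 2 * s * X * N := by gcongr
        _ = 2 * X * (s * N) := by ring
        _ ≤ 2 * X * (c * (X + s)) := by gcongr
        _ = _ := by ring
    exact le_of_mul_le_mul_right h3 (by positivity)
  have hbN : (b : ℝ) + 3 ≤ (s - s') * N / (2 * X) := by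
    have h3 : Real.exp ((r - a) * m) * Real.exp (a * m) = Real.exp (r * m) := by
      rw [← Real.exp_add]; congr 1; ring
    have h4 : 1 ≤ Real.exp ((r - a) * m) := Real.one_le_exp (mul_nonneg (by linarith) hm0)
    rw [le_div_iff₀ (by positivity)]
    calc ((b : ℝ) + 3) * (2 * X) ≤ (4 * Real.exp ((r - a) * m)) * (2 * X) := by
          gcongr; linarith
      _ = Real.exp ((r - a) * m) * (8 * r * m + 8 * r) := by rw [hX]; ring
      _ ≤ Real.exp ((r - a) * m) * ((s - s') * Real.exp (a * m)) := by gcongr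
      _ = (s - s') * Real.exp (r * m) := by rw [← h3]; ring
      _ ≤ (s - s') * N := mul_le_mul_of_nonneg_left hNm (sub_pos.2 hss).le
  have hj : (2 * ⌊s' * N / (2 * r * (m + 1))⌋₊ : ℝ) ≤ s' * N / X := by
    have h3 := Nat.floor_le (a := s' * N / (2 * r * (m + 1))) (by positivity)
    calc (2 * ⌊s' * N / (2 * r * (m + 1))⌋₊ : ℝ) ≤ 2 * (s' * N / (2 * r * (m + 1))) := by gcongr
      _ = s' * N / X := by rw [hX]; field_simp
  have hsplit : (s + s') * N / (2 * X) = s' * N / X + (s - s') * N / (2 * X) := by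
    field_simp; ring
  have : (2 * ⌊s' * N / (2 * r * (m + 1))⌋₊ + 3 + b : ℝ) ≤ c := by linarith
  exact_mod_cast this

/-- The arithmetic of the exponents in the upper bound. -/
lemma eventually_gapChain_bound_le {s α t κ δ ε θ C : ℝ} (hs : 0 < s) (hα : 0 < α) (ht : 0 ≤ t)
    (hκ0 : 0 < κ) (hκ : κ = α * s - t) (hδ : 0 < δ) (hδ1 : δ ≤ 1 / 4)
    (hδκ : δ * (12 * (α * s)) ≤ κ) (hε : 0 < ε) (hεκ : ε ≤ κ / 16) (hθ : θ = κ / 16) (K : ℕ) :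
    ∀ᶠ N : ℕ in atTop, ∀ X : ℝ, 0 ≤ X → X ≤ K * Nat.log 2 N + 1 →
      (N + 1) * ((X * Real.exp (-(α * (1 - δ) * Real.log 2 * Nat.log 2 N) + C) *
        (1 - Real.exp (-θ))⁻¹) ^ ⌊s * N / (2 * Real.log 2 * (Nat.log 2 N + 1))⌋₊ *
        Real.exp ((t + ε) * (N / 2 : ℕ) + θ * N)) ≤ Real.exp (-(κ / 8 * N)) := by
  set r := Real.log 2 with hr
  have hr0 : 0 < r := Real.log_pos (by norm_num)
  have hθ0 : 0 < 1 - Real.exp (-θ) := by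
    have : 0 < θ := by rw [hθ]; positivity
    simpa using this
  have e1 := tendsto_log_two_atTop.eventually (eventually_linear_le_mul_exp
    (a := α * r * δ) (c := Real.exp (-C) * (1 - Real.exp (-θ))) (by positivity)
    (by positivity) (K + 1))
  have e2 := tendsto_log_two_atTop.eventually
    (eventually_linear_le_mul_exp hr0 (by positivity : 0 < κ / 16) (α * r))
  have e3 := tendsto_log_two_atTop.eventually (eventually_ge_atTop ⌈1 / δ⌉₊)
  have e4 := eventually_linear_le_mul_exp (a := κ / 32) (by positivity) one_pos 1
  filter_upwards [e1, e2, e3, e4, eventually_ge_atTop 1] with N h1 h2 h3 h4 hN X hX0 hX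
  set m := Nat.log 2 N with hm
  have hm0 : (0 : ℝ) ≤ m := Nat.cast_nonneg m
  have hNm := exp_log_two_mul_le hN
  rw [← hr, ← hm] at hNm
  have hN0 : (0 : ℝ) < N := by exact_mod_cast hN
  set J := s * N / (2 * r * (m + 1)) with hJ
  set j := ⌊J⌋₊ with hj
  have hbase : X * Real.exp (-(α * (1 - δ) * r * m) + C) * (1 - Real.exp (-θ))⁻¹ ≤
      Real.exp (-(α * r * (1 - 2 * δ) * m)) := by
    have h5 : X ≤ Real.exp (-C) * (1 - Real.exp (-θ)) * Real.exp (α * r * δ * m) := by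
      refine hX.trans (le_trans ?_ h1)
      have : (0 : ℝ) ≤ K := Nat.cast_nonneg K
      linarith
    calc X * Real.exp (-(α * (1 - δ) * r * m) + C) * (1 - Real.exp (-θ))⁻¹
        ≤ (Real.exp (-C) * (1 - Real.exp (-θ)) * Real.exp (α * r * δ * m)) *
          Real.exp (-(α * (1 - δ) * r * m) + C) * (1 - Real.exp (-θ))⁻¹ := by gcongr
      _ = Real.exp (-C) * Real.exp (α * r * δ * m) * Real.exp (-(α * (1 - δ) * r * m) + C) := by
          field_simp
      _ = _ := by
          rw [← Real.exp_add, ← Real.exp_add]; congr 1; ring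
  -- The loss `1 - δ` bounds `m / (m + 1)` from below once `m ≥ 1/δ`; the term `m` comes from the
  -- floor.
  have hJlow : s * (1 - δ) * N / (2 * r) - m ≤ m * j := by
    have h5 := Nat.lt_floor_add_one J
    rw [← hj] at h5
    have h6 : 1 / δ ≤ m := (Nat.le_ceil _).trans (by exact_mod_cast h3)
    rw [div_le_iff₀ hδ] at h6
    have h7 : s * (1 - δ) * N / (2 * r) ≤ m * J := by
      have e : m * J = s * N / (2 * r) * (m / (m + 1)) := by rw [hJ]; field_simp
      have e' : s * (1 - δ) * N / (2 * r) = s * N / (2 * r) * (1 - δ) := by ring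
      rw [e, e']
      refine mul_le_mul_of_nonneg_left ?_ (by positivity)
      rw [le_div_iff₀ (by positivity)]
      linarith
    have h8 : m * J ≤ m * (j + 1) := mul_le_mul_of_nonneg_left h5.le hm0
    linarith
  have hpow : (X * Real.exp (-(α * (1 - δ) * r * m) + C) * (1 - Real.exp (-θ))⁻¹) ^ j ≤
      Real.exp (-(α * s * (1 - 3 * δ) / 2 * N) + κ / 16 * N) := by
    refine (pow_le_pow_left₀ (by positivity) hbase j).trans ?_
    rw [← Real.exp_nat_mul]
    refine Real.exp_le_exp.2 ?_
    have h5 : 0 ≤ α * r * (1 - 2 * δ) := mul_nonneg (by positivity) (by linarith)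
    have h6 := mul_le_mul_of_nonneg_left hJlow h5
    have h7 : α * r * (1 - 2 * δ) * (s * (1 - δ) * N / (2 * r)) =
        α * s * ((1 - 2 * δ) * (1 - δ)) / 2 * N := by field_simp
    have h8 : α * s * (1 - 3 * δ) / 2 * N ≤ α * s * ((1 - 2 * δ) * (1 - δ)) / 2 * N := by
      have : 1 - 3 * δ ≤ (1 - 2 * δ) * (1 - δ) := by
        have e : (1 - 2 * δ) * (1 - δ) = 1 - 3 * δ + 2 * δ ^ 2 := by ring
        have := sq_nonneg δ
        linarith
      gcongr
    have h9 : α * r * (1 - 2 * δ) * m ≤ κ / 16 * N := by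
      have h10 : α * r * (1 - 2 * δ) * m ≤ α * r * m := by
        have : 0 ≤ α * r * m * δ := by positivity
        linarith
      have h11 : 0 ≤ α * r := by positivity
      have h12 : κ / 16 * Real.exp (r * m) ≤ κ / 16 * N :=
        mul_le_mul_of_nonneg_left hNm (by positivity)
      linarith
    rw [mul_sub, h7] at h6
    linarith
  have hhalf : ((N / 2 : ℕ) : ℝ) ≤ N / 2 := Nat.cast_div_le
  have hexp : (t + ε) * (N / 2 : ℕ) + θ * N ≤ (t / 2 + κ / 32 + κ / 16) * N := by
    have h5 : (t + ε) * (N / 2 : ℕ) ≤ (t + ε) * (N / 2) :=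
      mul_le_mul_of_nonneg_left hhalf (by positivity)
    have h6 : ε * N ≤ κ / 16 * N := mul_le_mul_of_nonneg_right hεκ hN0.le
    rw [hθ]
    linarith
  calc _ ≤ Real.exp (κ / 32 * N) *
        (Real.exp (-(α * s * (1 - 3 * δ) / 2 * N) + κ / 16 * N) *
          Real.exp ((t / 2 + κ / 32 + κ / 16) * N)) := by
        gcongr
        linarith
    _ = Real.exp (κ / 32 * N + (-(α * s * (1 - 3 * δ) / 2 * N) + κ / 16 * N +
          (t / 2 + κ / 32 + κ / 16) * N)) := by rw [← Real.exp_add, ← Real.exp_add]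
    _ ≤ _ := by
        refine Real.exp_le_exp.2 ?_
        have h5 : δ * (12 * (α * s)) * N ≤ κ * N := mul_le_mul_of_nonneg_right hδκ hN0.le
        have h6 : t * N = α * s * N - κ * N := by rw [hκ]; ring
        have h7 : 0 ≤ κ * N := by positivity
        linarith

end UpperEstimates

/-! ### The upper bound for the estimator -/

section Upper

variable {A : Type*} [Fintype A] [MeasurableSpace A] [DiscreteMeasurableSpace A]
  {P Q : Measure (ℕ → A)} [IsProbabilityMeasure P] [IsProbabilityMeasure Q]

-- A value above `s` forces more than about `sN / ln N` words, almost all long and all but the last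
-- improbable. Alternate ones form a chain with gaps whose `Q`-probability, summed over starting
-- points, is exponentially small in `N`.
open Classical in
theorem ae_eventually_mzmEstimator_le (hPinv : MeasurePreserving shift P P)
    (hQinv : MeasurePreserving shift Q Q) (hPsld : SelectivelyLowerDecoupled P)
    (hQud : UpperDecoupled Q) (hnd : Nondegenerate P Q) (hsupp : seqSupport Q ⊆ seqSupport P)
    {s α : ℝ} (hα : 0 < α) (hs : pressure P Q α < ((s * α : ℝ) : EReal)) :
    ∀ᵐ xy ∂(P.prod Q), ∀ᶠ N : ℕ in atTop, mzmEstimator N xy.2 xy.1 ≤ (s : EReal) := by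
  obtain ⟨t, ht1, ht2⟩ := EReal.lt_iff_exists_real_btwn.1 hs
  rw [EReal.coe_lt_coe_iff] at ht2
  have ht0 : 0 < t := by
    have := (pressure_nonneg hsupp hα.le).trans_lt ht1
    exact_mod_cast this
  have hs0 : 0 < s := pos_of_mul_pos_left (ht0.trans ht2) hα.le
  set s' := (s + t / α) / 2 with hs'
  have htα : t / α < s := by rwa [div_lt_iff₀ hα]
  have htα0 : 0 < t / α := by positivity
  have hs'0 : 0 < s' := by positivity
  have hss : s' < s := by rw [hs']; linarith
  set κ := α * s' - t with hκ
  have hκ0 : 0 < κ := by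
    have : α * (t / α) < α * s' := mul_lt_mul_of_pos_left (by rw [hs']; linarith) hα
    rw [mul_div_cancel₀ _ hα.ne'] at this
    linarith
  set r := Real.log 2 with hr
  have hr0 : 0 < r := Real.log_pos (by norm_num)
  set δ := min (1 / 4) (κ / (12 * (α * s'))) with hδ
  have hδ0 : 0 < δ := lt_min (by norm_num) (by positivity)
  have hδ1 : δ ≤ 1 / 4 := min_le_left _ _
  have hδκ : δ * (12 * (α * s')) ≤ κ := by
    rw [← le_div_iff₀ (by positivity)]; exact min_le_right _ _
  obtain ⟨K, hK1, hmatch⟩ := hnd.exists_ae_eventually_seenIn_le hPinv hQinv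
  -- Words shorter than `ζm` count as short. Over such a length the factor `exp(tl)` loses at most a
  -- quarter of the gain `2^(-αm)`, up to a constant, so improbable short words stay rare.
  set ζ := α * r / (4 * t) with hζ
  have hζ0 : 0 < ζ := by positivity
  have htζ : t * ζ = α * r / 4 := by rw [hζ]; field_simp
  -- With this `ε`, a gap of length `ζm` suffices to decouple words of length up to `(K + 1)m`.
  set ε := min (ζ / (2 * (K + 1))) (κ / 16) with hε
  have hε0 : 0 < ε := lt_min (by positivity) (by positivity)
  have hεκ : ε ≤ κ / 16 := min_le_right _ _
  have hεζ : ε * (K + 1) ≤ ζ / 2 := by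
    have : ε ≤ ζ / (2 * (K + 1)) := min_le_left _ _
    rw [le_div_iff₀ (by positivity)] at this
    linarith
  set θ := κ / 16 with hθ
  have hθ0 : 0 < θ := by positivity
  set a := min (α * r / 4) r with ha
  have ha0 : 0 < a := lt_min (by positivity) hr0
  have har : a ≤ r := min_le_right _ _
  have haα : a ≤ α * r / 4 := min_le_left _ _
  obtain ⟨C, hC0, hC⟩ := exists_crossSum_le ht1
  obtain ⟨C', hC'0, hdec⟩ := hQud.exists_real_inter_le hQinv hε0
  set thr : ℕ → ℝ := fun m => Real.exp (-((1 - δ) * r * m)) with hthr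
  set d₀ : ℕ → ℕ := fun m => ⌈ζ * m⌉₊ with hd₀
  set jN : ℕ → ℕ := fun N => ⌊s' * N / (2 * r * (Nat.log 2 N + 1))⌋₊ with hjN
  have hGprob : ∀ m l : ℕ, Q.real (improbableEvent P (thr m) l) ≤
      Real.exp (-(α * (1 - δ) * r * m) + (t * l + C)) := by
    intro m l
    refine (real_improbableEvent_le hsupp l hα (Real.exp_pos _)).trans ?_
    rw [Real.exp_add, ← Real.exp_mul]
    refine mul_le_mul (le_of_eq ?_) (hC l) (crossSum_nonneg P Q l α) (Real.exp_nonneg _)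
    congr 1; ring
  have hGdet : ∀ m l, PrefixDetermined (improbableEvent P (thr m) l) := fun m l =>
    PrefixDetermined.firstWord_mem _
  have hshort : ∀ᵐ y ∂Q, ∀ᶠ m : ℕ in atTop, ¬ Real.exp ((r - a) * m) ≤
      (((Finset.range (2 ^ (m + 1))).filter
        (fun p => shift^[p] y ∈ improbableEvent P (thr m) (d₀ m))).card : ℝ) := by
    refine ae_eventually_notMem_of_summable
      (s := fun m => {y | Real.exp ((r - a) * m) ≤ (((Finset.range (2 ^ (m + 1))).filter
        (fun p => shift^[p] y ∈ improbableEvent P (thr m) (d₀ m))).card : ℝ)})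
      ((summable_exp_neg_mul (a := α * r / 4) (by positivity)).mul_left (2 * Real.exp (t + C)))
      (Eventually.of_forall fun m => ?_)
    refine (real_setOf_le_card_le (μ := Q) (s := Finset.range (2 ^ (m + 1)))
      (E := fun p => shift^[p] ⁻¹' improbableEvent P (thr m) (d₀ m))
      (fun p _ => measurable_shift_iterate p (hGdet m _).measurableSet) (Real.exp_pos _)).trans ?_
    rw [div_le_iff₀ (Real.exp_pos _)]
    have h1 : ∀ p ∈ Finset.range (2 ^ (m + 1)),
        Q.real (shift^[p] ⁻¹' improbableEvent P (thr m) (d₀ m)) ≤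
          Real.exp (-(α * r / 2 * m) + (t + C)) := by
      intro p _
      rw [real_preimage_shift hQinv p (hGdet m _).measurableSet]
      refine (hGprob m _).trans (Real.exp_le_exp.2 ?_)
      have h2 := Nat.ceil_lt_add_one (a := ζ * m) (by positivity)
      have h3 : t * (d₀ m : ℝ) ≤ t * (ζ * m + 1) := mul_le_mul_of_nonneg_left h2.le ht0.le
      have h4 : t * (ζ * m + 1) = α * r / 4 * m + t := by rw [← htζ]; ring
      have h5 : δ * (α * r * m) ≤ 1 / 4 * (α * r * m) :=
        mul_le_mul_of_nonneg_right hδ1 (by positivity)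
      linarith
    refine (Finset.sum_le_sum h1).trans ?_
    rw [Finset.sum_const, Finset.card_range, nsmul_eq_mul]
    push_cast
    rw [pow_succ, two_pow_eq_exp, ← hr]
    calc Real.exp (r * m) * 2 * Real.exp (-(α * r / 2 * m) + (t + C))
        = 2 * Real.exp (r * m + (-(α * r / 2 * m) + (t + C))) := by
          rw [Real.exp_add (r * m)]; ring
      _ ≤ 2 * Real.exp ((t + C) + -(α * r / 4 * m) + (r - a) * m) := by
          refine mul_le_mul_of_nonneg_left (Real.exp_le_exp.2 ?_) (by norm_num)
          have := mul_le_mul_of_nonneg_right haα (Nat.cast_nonneg (α := ℝ) m)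
          linarith
      _ = _ := by rw [Real.exp_add, Real.exp_add]; ring
  have hchain : ∀ᵐ y ∂Q, ∀ᶠ N : ℕ in atTop, y ∉ ⋃ o ∈ Finset.range (N + 1), shift^[o] ⁻¹'
      gapChainEvent (improbableEvent P (thr (Nat.log 2 N)))
        (Finset.Icc (d₀ (Nat.log 2 N)) ((K + 1) * Nat.log 2 N)) (d₀ (Nat.log 2 N)) (jN N)
        (N / 2) N := by
    refine ae_eventually_notMem_of_summable
      (summable_exp_neg_mul (a := κ / 8) (by positivity)) ?_
    filter_upwards [eventually_gapChain_bound_le (C := C + C') hs'0 hα ht0.le hκ0 hκ hδ0 hδ1 hδκ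
      hε0 hεκ hθ (K + 1), tendsto_log_two_atTop.eventually
      (eventually_ge_atTop ⌈C' / (ζ / 2)⌉₊)] with N h1 h2
    set m := Nat.log 2 N with hm
    have hCm : C' ≤ ζ / 2 * m := by
      have : C' / (ζ / 2) ≤ m := (Nat.le_ceil _).trans (by exact_mod_cast h2)
      rwa [div_le_iff₀' (by positivity)] at this
    have hdec' : ∀ l ∈ Finset.Icc (d₀ m) ((K + 1) * m), ∀ d, d₀ m ≤ d →
        ∀ E, PrefixDetermined E →
        Q.real (improbableEvent P (thr m) l ∩ shift^[l + d] ⁻¹' E) ≤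
          Real.exp (-(α * (1 - δ) * r * m) + (C + C')) * Real.exp ((t + ε) * l) * Q.real E := by
      intro l hl d hd E hE
      have hlK : (l : ℝ) ≤ (K + 1) * m := by exact_mod_cast (Finset.mem_Icc.1 hl).2
      have hdζ : ζ * m ≤ d := (Nat.le_ceil _).trans (by exact_mod_cast hd)
      refine (hdec l d ?_ _ E hE).trans ?_
      · have h3 : ε * l ≤ ε * ((K + 1) * m) := mul_le_mul_of_nonneg_left hlK hε0.le
        have h4 : ε * (K + 1) * m ≤ ζ / 2 * m :=
          mul_le_mul_of_nonneg_right hεζ (Nat.cast_nonneg m)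
        linarith
      · rw [← mul_assoc]
        refine mul_le_mul_of_nonneg_right ?_ measureReal_nonneg
        refine (mul_le_mul_of_nonneg_left (hGprob m l) (Real.exp_nonneg _)).trans_eq ?_
        rw [← Real.exp_add, ← Real.exp_add]
        congr 1; ring
    have hone := real_gapChainEvent_le (hGdet m) (Real.exp_nonneg _) (by positivity) hθ0 hdec'
      (jN N) (N / 2) N
    refine (measureReal_biUnion_finset_le _ _).trans ?_
    rw [Finset.sum_congr rfl fun o _ => real_preimage_shift hQinv o
      (prefixDetermined_gapChainEvent (hGdet m) _ _ _ _ _).measurableSet,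
      Finset.sum_const, Finset.card_range, nsmul_eq_mul]
    have hcard : ((Finset.Icc (d₀ m) ((K + 1) * m)).card : ℝ) ≤ (K + 1 : ℕ) * m + 1 := by
      rw [Nat.card_Icc]
      have h3 : (K + 1) * m + 1 - d₀ m ≤ (K + 1) * m + 1 := Nat.sub_le _ _
      exact_mod_cast h3
    refine le_trans ?_ (h1 _ (Nat.cast_nonneg _) hcard)
    push_cast
    exact mul_le_mul_of_nonneg_left hone (by positivity)
  have hseen := hPsld.ae_eventually_seen hPinv (K + 1) hδ0 (by linarith : δ < 1)
  filter_upwards [hmatch, Measure.quasiMeasurePreserving_fst.ae hseen,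
    Measure.quasiMeasurePreserving_snd.ae hshort, Measure.quasiMeasurePreserving_snd.ae hchain]
    with xy h1 h2 h3 h4
  filter_upwards [tendsto_log_two_atTop.eventually h1, tendsto_log_two_atTop.eventually h2,
    tendsto_log_two_atTop.eventually h3, h4, eventually_two_mul_floor_add_le hs'0 hss ha0 har,
    tendsto_log_two_atTop.eventually (eventually_ge_atTop 1), eventually_ge_atTop 2]
    with N g1 g2 g3 g4 g5 hm hN
  by_contra hlt
  have hcount := lt_of_lt_mzmEstimator hN (not_le.1 hlt)
  obtain ⟨x, y⟩ := xy
  simp only at g1 g2 g3 g4 hcount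
  set m := Nat.log 2 N with hmdef
  have hNm : N ≤ 2 ^ (m + 1) := (lt_two_pow_log_succ N).le
  have hmN : 2 ^ m ≤ N := Nat.pow_log_le_self 2 (by omega)
  have hshortcard : (((Finset.range N).filter
      (fun p => shift^[p] y ∈ improbableEvent P (thr m) (d₀ m))).card : ℝ) ≤
      Real.exp ((r - a) * m) := by
    refine le_trans ?_ (not_le.1 g3).le
    exact_mod_cast Finset.card_le_card
      (Finset.filter_subset_filter _ (Finset.range_subset_range.2 hNm))
  have hc := g5 _ _ hcount hshortcard
  have hΛ : ∀ p < N, matchLength N (shift^[p] y) x + 1 ≤ (K + 1) * m := by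
    intro p hp
    have := matchLength_le (Nat.mul_pos hK1 hm) fun l hl =>
      g1 p (by omega) l (hl.mono hNm (le_refl l))
    rw [add_mul, one_mul]
    omega
  -- Words above the threshold already occur within the first `2^m ≤ N` letters of `x`, so unseen
  -- words are improbable.
  have hunseen : ∀ p < N, ∀ l, 1 ≤ l → l ≤ (K + 1) * m → ¬ SeenIn N l (shift^[p] y) x →
      shift^[p] y ∈ improbableEvent P (thr m) l := by
    intro p _ l hl1 hl2 hl
    by_contra hnot
    have h5 : thr m ≤ wordProb P (firstWord (shift^[p] y) l) := (not_le.1 hnot).le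
    exact hl ((notMem_unseenEvent_iff.1 (g2 l hl1 hl2 _ h5)).mono hmN (le_refl l))
  obtain ⟨o, ho, hmem⟩ := exists_gapChain_of_parse hΛ hunseen
    (fun l l' h => improbableEvent_mono P _ h) (le_refl _) hc
  refine g4 ?_
  simp only [Set.mem_iUnion]
  exact ⟨o, Finset.mem_range.2 (by omega), hmem⟩

end Upper

end ZivMerhav

/-! ### Conclusion -/

open ZivMerhav
theorem theorem2p1 {A : Type*} [Fintype A] [MeasurableSpace A] [DiscreteMeasurableSpace A]
    (P Q : Measure (ℕ → A)) [IsProbabilityMeasure P] [IsProbabilityMeasure Q]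
    (hPinv : MeasurePreserving shift P P) (hQinv : MeasurePreserving shift Q Q)
    (hPsld : SelectivelyLowerDecoupled P) (hPud : UpperDecoupled P)
    (hPse : DecaysSlowlyEnough P) (hQud : UpperDecoupled Q)
    (hnd : Nondegenerate P Q) (hsupp : seqSupport Q ⊆ seqSupport P) :
    ∃ Dm Dp : EReal,
      HasLeftDerivAtZero (pressure P Q) Dm ∧ HasRightDerivAtZero (pressure P Q) Dp ∧
      subdiffAtZero (pressure P Q) = {s : ℝ | Dm ≤ (s : EReal) ∧ (s : EReal) ≤ Dp} ∧
      ∀ᵐ xy ∂(P.prod Q),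
        Dm ≤ liminf (fun N : ℕ => mzmEstimator N xy.2 xy.1) atTop ∧
        liminf (fun N : ℕ => mzmEstimator N xy.2 xy.1) atTop ≤
          limsup (fun N : ℕ => mzmEstimator N xy.2 xy.1) atTop ∧
        limsup (fun N : ℕ => mzmEstimator N xy.2 xy.1) atTop ≤ Dp := by
  obtain ⟨Dm, Dp, hm, hp, hsub, hlow, hupp⟩ := exists_oneSided_derivs
    (pressure_zero hsupp) fun α t r hr0 hr1 h => pressure_mul_le hsupp hr0 hr1 h
  refine ⟨Dm, Dp, hm, hp, hsub, ?_⟩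
  -- Rational slopes, so that the exceptional null sets form a countable union.
  have h1 : ∀ᵐ xy ∂(P.prod Q), ∀ q : ℚ, ((q : ℝ) : EReal) < Dm →
      ∀ᶠ N : ℕ in atTop, ((q : ℝ) : EReal) ≤ mzmEstimator N xy.2 xy.1 := by
    refine ae_all_iff.2 fun q => ?_
    by_cases hq : ((q : ℝ) : EReal) < Dm
    · obtain ⟨β, hβ, hβ1, hs⟩ := hlow q hq
      filter_upwards [ae_eventually_le_mzmEstimator hPinv hQinv hPsld hQud hnd hsupp hβ hβ1 hs]
        with xy h _ using h
    · exact Eventually.of_forall fun xy h => absurd h hq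
  have h2 : ∀ᵐ xy ∂(P.prod Q), ∀ q : ℚ, Dp < ((q : ℝ) : EReal) →
      ∀ᶠ N : ℕ in atTop, mzmEstimator N xy.2 xy.1 ≤ ((q : ℝ) : EReal) := by
    refine ae_all_iff.2 fun q => ?_
    by_cases hq : Dp < ((q : ℝ) : EReal)
    · obtain ⟨α, hα, hs⟩ := hupp q hq
      filter_upwards [ae_eventually_mzmEstimator_le hPinv hQinv hPsld hQud hnd hsupp hα hs]
        with xy h _ using h
    · exact Eventually.of_forall fun xy h => absurd h hq
  filter_upwards [h1, h2] with xy g1 g2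
  refine ⟨le_of_forall_lt fun c hc => ?_, liminf_le_limsup, le_of_forall_gt fun c hc => ?_⟩
  · obtain ⟨q, hq1, hq2⟩ := EReal.lt_iff_exists_rat_btwn.1 hc
    exact hq1.trans_le (le_liminf_of_le (by isBoundedDefault) (g1 q hq2))
  · obtain ⟨q, hq1, hq2⟩ := EReal.lt_iff_exists_rat_btwn.1 hc
    exact (limsup_le_of_le (by isBoundedDefault) (g2 q hq1)).trans_lt hq2
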